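/- For $m\ge 1$ let $D_m$ be the Dyck language of properly balanced strings of parentheses of $m$ types. A string $x$ of length $n$ over this alphabet is $\varepsilon$-far from $D_m$ if its Hamming distance to every string of length $n$ in $D_m$ is larger than $\varepsilon n$. An $\varepsilon$-tester with bounded error $\eta$ for $D_m$-membership on inputs of length $n$ is a randomized, possibly adaptive, algorithm that accesses its input $x$ only by querying characters of $x$ one at a time, accepts every $x\in D_m$ of length $n$ with probability at least $1-\eta$, and rejects every $x$ of length $n$ that is $\varepsilon$-far from $D_m$ with probability at least $1-\eta$. Its query complexity is the maximum number of queries it performs, over all inputs of length $n$ and all random choices. **Corollary.** Testing $D_m$-membership, $m\ge 2$, requires $\Omega(n^{1/5})$ queries for some constant $\varepsilon$. Precisely: there is a constant $\varepsilon>0$ such that for every $\eta\in[0,1/2)$ (in particular for the usual $\eta=1/3$) there are constants $c>0$ and $N$ such that, for all $m\ge 2$ and all even $n\ge N$, every $\varepsilon$-tester with bounded error $\eta$ for $D_m$-membership on inputs of length $n$ has query complexity at least $c\,n^{1/5}$. -/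

import Mathlib

/-- The alphabet of parentheses of `m` types. -/
inductive Paren (m : ℕ) : Type
  | opening (t : Fin m) : Paren m
  | closing (t : Fin m) : Paren m
  deriving DecidableEq

/-- Properly balanced strings of parentheses of `m` types: the empty string is balanced, and if `u`
and `v` are balanced then so is `(ₜ u )ₜ v` for every type `t`. -/
inductive IsBalanced {m : ℕ} : List (Paren m) → Prop
  | nil : IsBalanced []
  | node (t : Fin m) {u v : List (Paren m)} (hu : IsBalanced u) (hv : IsBalanced v) :
      IsBalanced (Paren.opening t :: (u ++ Paren.closing t :: v))

/-- The Dyck language `D_m`. -/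
def dyckLanguage (m : ℕ) : Language (Paren m) := {w | IsBalanced w}

/-- The strings of length `n` that belong to the language `L`. -/
def stringsOfLength {α : Type} (L : Language α) (n : ℕ) : Set (Fin n → α) :=
  {x | List.ofFn x ∈ L}

/-- The string `x` of length `n` is `ε`-far from all members of `P`: more than `ε n` characters have
to be changed in order to reach a member of `P`. -/
def IsFar {α : Type} [DecidableEq α] {n : ℕ} (ε : ℝ) (x : Fin n → α)
    (P : Set (Fin n → α)) : Prop :=
  ∀ y ∈ P, ε * n < hammingDist x y

/-- Deterministic adaptive query algorithms on strings of length `n` over `α`: such an algorithm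
either stops and answers (`true` is "accept", `false` is "reject"), or queries a position of the
input and continues depending on the character it has read. -/
inductive QueryAlg (n : ℕ) (α : Type) : Type
  | answer (b : Bool) : QueryAlg n α
  | query (i : Fin n) (next : α → QueryAlg n α) : QueryAlg n α

namespace QueryAlg

/-- The answer of the algorithm on the input `x`. -/
def run {n : ℕ} {α : Type} : QueryAlg n α → (Fin n → α) → Bool
  | answer b, _ => b
  | query i next, x => (next (x i)).run x

/-- The number of queries performed by the algorithm on the input `x`. -/
def numQueries {n : ℕ} {α : Type} : QueryAlg n α → (Fin n → α) → ℕ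
  | answer _, _ => 0
  | query i next, x => (next (x i)).numQueries x + 1

end QueryAlg

/-- Randomized adaptive query algorithms: probability distributions over deterministic ones (the
random choices are drawn in advance, independently of the input; over a finite alphabet there are
only countably many deterministic algorithms, so discrete distributions are all there are). -/
abbrev RandQueryAlg (n : ℕ) (α : Type) : Type := PMF (QueryAlg n α)

namespace RandQueryAlg

/-- The probability that the randomized algorithm answers `b` on the input `x`. -/
noncomputable def prob {n : ℕ} {α : Type} (A : RandQueryAlg n α) (x : Fin n → α) (b : Bool) : ℝ :=
  ((PMF.map (fun T : QueryAlg n α => T.run x) A) b).toReal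

/-- The worst case query complexity of `A` is at most `q`: whatever the input and the random
choices are, `A` performs at most `q` queries. -/
def QueriesAtMost {n : ℕ} {α : Type} (A : RandQueryAlg n α) (q : ℕ) : Prop :=
  ∀ T ∈ PMF.support A, ∀ x : Fin n → α, T.numQueries x ≤ q

/-- `A` is an `ε`-tester with bounded error `η` for the language `L` on inputs of length `n`. -/
def IsTester {n : ℕ} {α : Type} [DecidableEq α] (A : RandQueryAlg n α) (ε η : ℝ)
    (L : Language α) : Prop :=
  (∀ x ∈ stringsOfLength L n, 1 - η ≤ A.prob x true) ∧
    ∀ x : Fin n → α, IsFar ε x (stringsOfLength L n) → 1 - η ≤ A.prob x false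

end RandQueryAlg

/-! A random input consists of `a` pairs that are `((` or `()` according to fair bits `A`, then `L`
opening parentheses with types `w`, then `a` pairs governed by the negated bits, then `L + 2a`
closing parentheses with types `v`, indexed from the right end. The total height does not depend on
`A`, but the closing partner of `w i` is `v (i + 2K)`, where `K = trueCount A`. If `w` copies `v`
along this shift and `v` vanishes near its ends, the input is balanced (`isBalanced_hardInput`); in
the other distribution `w` and `v` are independent.

Telling the two apart requires querying both ends of a matched pair. Unless the algorithm reads most
of `A`, each value of `K` has conditional probability at most `1/√b`, with `b` of the order of `a`,
so a union bound over `q²` pairs gives a loss `q²/√b`. The bias of `v` rises and falls with slope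
`1/(2R)`, so shifting by `2K` changes it by at most `a/R`; this costs a factor `1 - 2a/R` per query
(`le_sum_shifted_bitsWeight`). The comparison on fixed query sets passes to adaptive trees and then
to their mixtures (`QueryAlg.le_sum_run`, `RandQueryAlg.le_sum_prob`).

Independent types are usually far from balanced by counting: up to its shape, a balanced word of
length `2h` carries only `h` type bits, whereas `w` and `v` together carry nearly `2h` fair bits
(`card_close_le`, `sum_hardInput_not_isFar_le`).

Both losses are small when `q² ≪ √a` and `q a ≪ n`, that is, for `a ≈ n^(4/5)` and `q ≪ n^(1/5)`. -/

/-! ### Coding balanced words, and counting type strings close to them -/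

theorem IsBalanced.append {m : ℕ} {u v : List (Paren m)} (hu : IsBalanced u)
    (hv : IsBalanced v) : IsBalanced (u ++ v) := by
  induction hu with
  | nil => simpa using hv
  | node t h₁ _ _ ih₂ => simpa using IsBalanced.node t h₁ ih₂

theorem IsBalanced.wrap {m : ℕ} {u : List (Paren m)} (t : Fin m) (hu : IsBalanced u) :
    IsBalanced (Paren.opening t :: (u ++ [Paren.closing t])) :=
  IsBalanced.node t hu IsBalanced.nil

/-- Forget all about a parenthesis but whether it is an opening one, and whether its type is
different from the type `0`. -/
def Paren.toBits {m : ℕ} : Paren m → Bool × Bool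
  | opening t => (true, decide (t.val ≠ 0))
  | closing t => (false, decide (t.val ≠ 0))

@[simp]
theorem Paren.toBits_opening {m : ℕ} (t : Fin m) :
    (Paren.opening t).toBits = (true, decide (t.val ≠ 0)) := rfl

@[simp]
theorem Paren.toBits_closing {m : ℕ} (t : Fin m) :
    (Paren.closing t).toBits = (false, decide (t.val ≠ 0)) := rfl

/-- The types (zero or nonzero) of the opening parentheses of a word, in order. -/
def openingBits {m : ℕ} : List (Paren m) → List Bool
  | [] => []
  | Paren.opening t :: l => decide (t.val ≠ 0) :: openingBits l
  | Paren.closing _ :: l => openingBits l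

/-- Reconstruct a word from its shape and the types of its opening parentheses, with the help of a
stack. -/
def reconstruct : List Bool → List Bool → List Bool → List (Bool × Bool)
  | true :: s, b :: o, st => (true, b) :: reconstruct s o (b :: st)
  | false :: s, o, c :: st => (false, c) :: reconstruct s o st
  | _, _, _ => []

theorem openingBits_append {m : ℕ} (u v : List (Paren m)) :
    openingBits (u ++ v) = openingBits u ++ openingBits v := by
  induction u with
  | nil => rfl
  | cons a u ih => cases a <;> simp [openingBits, ih]

theorem IsBalanced.two_mul_length_openingBits {m : ℕ} {u : List (Paren m)} (hu : IsBalanced u) :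
    2 * (openingBits u).length = u.length := by
  induction hu with
  | nil => rfl
  | node t _ _ ih₁ ih₂ =>
    simp only [openingBits, openingBits_append, List.length_cons, List.length_append]
    omega

/-- A balanced block pops exactly what it has pushed, so the stack beneath it is untouched. The
arbitrary continuation `s`, `o`, `st` is what makes the induction go through. -/
theorem IsBalanced.reconstruct_append {m : ℕ} {u : List (Paren m)} (hu : IsBalanced u) :
    ∀ s o st : List Bool, reconstruct (u.map (fun p => p.toBits.1) ++ s) (openingBits u ++ o) st =
      u.map Paren.toBits ++ reconstruct s o st := by
  induction hu with
  | nil => intro s o st; rfl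
  | node t _ _ ih₁ ih₂ =>
    intro s o st
    simp [openingBits, openingBits_append, reconstruct, ih₁, ih₂]

/-- A balanced word of length `2 h` is determined, up to the identification of all nonzero types, by
its shape and by `h` bits. -/
theorem exists_types_of_balanced (h : ℕ) :
    ∃ F : (Fin (2 * h) → Bool) → (Fin h → Bool) → Fin (2 * h) → Bool,
      ∀ (m : ℕ) (y : Fin (2 * h) → Paren m), IsBalanced (List.ofFn y) →
        ∃ S o, ∀ i, (y i).toBits = (S i, F S o i) := by
  -- The default of `getD` is never reached for codes of balanced words.
  refine ⟨fun S o i => ((reconstruct (List.ofFn S) (List.ofFn o) []).getD i (true, true)).2, ?_⟩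
  intro m y hy
  have hlen : (openingBits (List.ofFn y)).length = h := by
    have := hy.two_mul_length_openingBits
    simp at this
    exact this
  refine ⟨fun i => (y i).toBits.1, fun i => (openingBits (List.ofFn y))[i.val], fun i => ?_⟩
  have h1 := hy.reconstruct_append [] [] []
  have h2 : List.ofFn (fun i : Fin h => (openingBits (List.ofFn y))[i.val]) =
      openingBits (List.ofFn y) := by
    apply List.ext_getElem
    · simp [hlen]
    · intro k _ _
      simp
  have h3 : List.ofFn (fun i => (y i).toBits.1) =
      (List.ofFn y).map (fun p => p.toBits.1) := by
    rw [List.map_ofFn]; rfl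
  simp only [List.append_nil, reconstruct] at h1
  simp only [h2, h3, h1]
  simp

/-- A string of types makes a word of a given shape close to balanced only rarely. -/
theorem card_close_le {h : ℕ} (m d : ℕ) (S : Fin (2 * h) → Bool)
    (C : Finset (Fin (2 * h) → Bool)) (hC : ∀ T ∈ C, ∃ y : Fin (2 * h) → Paren m,
      IsBalanced (List.ofFn y) ∧
        hammingDist (fun i => (S i, T i)) (fun i => (y i).toBits) ≤ d) :
    (C.card : ℝ) ≤ 2 ^ h * (19 / 16) ^ (2 * h) * 16 ^ d := by
  obtain ⟨F, hF⟩ := exists_types_of_balanced h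
  -- Exponential Markov bound: each mismatch has weight `1/16`, each `T` within distance `d` has
  -- weight at least `16 ^ (-d)`. Summing over the bit `T i` gives `1 + 1/16` if the shapes agree at
  -- `i`, and `2/16` if they do not.
  have key : ∀ S' T' : Fin (2 * h) → Bool,
      ((Finset.univ.filter fun T : Fin (2 * h) → Bool =>
        hammingDist (fun i => (S i, T i)) (fun i => (S' i, T' i)) ≤ d).card : ℝ) ≤
      16 ^ d * ∏ i, (if S i = S' i then 17 / 16 else 2 / 16 : ℝ) := by
    intro S' T'
    have h1 : ∀ i, (if S i = S' i then 17 / 16 else 2 / 16 : ℝ) =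
        ∑ b : Bool, (if (S i, b) = (S' i, T' i) then 1 else 1 / 16 : ℝ) := by
      intro i
      by_cases hs : S i = S' i <;> cases T' i <;> simp [hs] <;> norm_num
    simp_rw [h1]
    rw [Finset.prod_univ_sum, Finset.mul_sum, Fintype.piFinset_univ, Finset.card_filter]
    push_cast
    refine Finset.sum_le_sum fun T _ => ?_
    have h2 : ∏ i, (if (S i, T i) = (S' i, T' i) then 1 else 1 / 16 : ℝ) =
        (1 / 16) ^ hammingDist (fun i => (S i, T i)) (fun i => (S' i, T' i)) := by
      rw [Finset.prod_ite]
      simp [hammingDist]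
    rw [h2]
    split_ifs with hd
    · calc (1 : ℝ) = 16 ^ d * (1 / 16) ^ d := by rw [← mul_pow]; norm_num
        _ ≤ _ := by
          gcongr ?_ * ?_
          exact pow_le_pow_of_le_one (by norm_num) (by norm_num) hd
    · positivity
  have hsub : C ⊆
      (Finset.univ : Finset ((Fin (2 * h) → Bool) × (Fin h → Bool))).biUnion fun p =>
        Finset.univ.filter fun T : Fin (2 * h) → Bool =>
        hammingDist (fun i => (S i, T i)) (fun i => (p.1 i, F p.1 p.2 i)) ≤ d := by
    intro T hT
    simp only [Finset.mem_filter, Finset.mem_univ, true_and, Finset.mem_biUnion]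
    obtain ⟨y, hy, hd⟩ := hC T hT
    obtain ⟨S', o, ho⟩ := hF m y hy
    refine ⟨(S', o), ?_⟩
    simpa only [← ho] using hd
  -- Summing over all shapes costs only `17/16 + 2/16` per position, so no separate union bound over
  -- the `4 ^ h` shapes is needed.
  have h3 : (∑ S' : Fin (2 * h) → Bool, ∏ i, (if S i = S' i then 17 / 16 else 2 / 16 : ℝ)) =
      (19 / 16) ^ (2 * h) := by
    have := Finset.prod_univ_sum (fun _ : Fin (2 * h) => (Finset.univ : Finset Bool))
      (fun i b => (if S i = b then 17 / 16 else 2 / 16 : ℝ))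
    rw [Fintype.piFinset_univ] at this
    rw [← this]
    have h4 : ∀ i, ∑ b : Bool, (if S i = b then 17 / 16 else 2 / 16 : ℝ) = 19 / 16 := by
      intro i
      cases S i <;> simp <;> norm_num
    simp only [h4, Finset.prod_const, Finset.card_univ, Fintype.card_fin]
  calc _ ≤ ((∑ p : (Fin (2 * h) → Bool) × (Fin h → Bool), (Finset.univ.filter fun T :
        Fin (2 * h) → Bool =>
        hammingDist (fun i => (S i, T i)) (fun i => (p.1 i, F p.1 p.2 i)) ≤ d).card : ℕ) : ℝ) := by
        exact_mod_cast (Finset.card_le_card hsub).trans Finset.card_biUnion_le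
    _ ≤ ∑ p : (Fin (2 * h) → Bool) × (Fin h → Bool),
        16 ^ d * ∏ i, (if S i = p.1 i then 17 / 16 else 2 / 16 : ℝ) := by
        push_cast
        exact Finset.sum_le_sum fun p _ => key _ _
    _ = _ := by
        rw [Fintype.sum_prod_type_right]
        simp only [Finset.sum_const, Finset.card_univ, Fintype.card_fun, Fintype.card_bool,
          Fintype.card_fin, nsmul_eq_mul, ← Finset.mul_sum, h3]
        push_cast
        ring

/-! ### Indicators and independent biased bits -/

/-- The indicator of a proposition. -/
noncomputable def ind (P : Prop) : ℝ := by
  classical exact if P then 1 else 0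

theorem ind_of_true {P : Prop} (h : P) : ind P = 1 := by simp [ind, h]

theorem ind_of_false {P : Prop} (h : ¬P) : ind P = 0 := by simp [ind, h]

theorem ind_nonneg (P : Prop) : 0 ≤ ind P := by
  by_cases h : P <;> simp [ind, h]

theorem ind_le_one (P : Prop) : ind P ≤ 1 := by
  by_cases h : P <;> simp [ind, h]

theorem ind_and (P Q : Prop) : ind (P ∧ Q) = ind P * ind Q := by
  by_cases h : P <;> by_cases h' : Q <;> simp [ind, h, h']

theorem ind_mono {P Q : Prop} (h : P → Q) : ind P ≤ ind Q := by
  by_cases hP : P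
  · rw [ind_of_true hP, ind_of_true (h hP)]
  · rw [ind_of_false hP]; exact ind_nonneg Q

theorem ind_forall {ι : Type*} [Fintype ι] (P : ι → Prop) : ind (∀ i, P i) = ∏ i, ind (P i) := by
  by_cases h : ∀ i, P i
  · simp [ind_of_true h, ind_of_true (h _)]
  · rw [ind_of_false h]
    push Not at h
    obtain ⟨i, hi⟩ := h
    exact (Finset.prod_eq_zero (Finset.mem_univ i) (ind_of_false hi)).symm

theorem sum_ind {ι : Type*} [Fintype ι] (P : ι → Prop) [DecidablePred P] :
    ∑ i, ind (P i) = ((Finset.univ.filter P).card : ℝ) := by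
  rw [Finset.card_filter]
  push_cast
  refine Finset.sum_congr rfl fun i _ => ?_
  by_cases h : P i
  · rw [ind_of_true h, if_pos h]
  · rw [ind_of_false h, if_neg h]

/-- The probability of the value `b` of a random bit that is `true` with probability `p`. -/
def bitWeight (p : ℝ) (b : Bool) : ℝ := if b then p else 1 - p

theorem bitWeight_nonneg {p : ℝ} (h0 : 0 ≤ p) (h1 : p ≤ 1) (b : Bool) : 0 ≤ bitWeight p b := by
  cases b <;> simp [bitWeight] <;> linarith

theorem sum_bitWeight (p : ℝ) : ∑ b, bitWeight p b = 1 := by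
  simp [bitWeight]

/-- The probability of the outcome `v` of independent random bits with biases `p`. -/
noncomputable def bitsWeight {ι : Type*} [Fintype ι] (p : ι → ℝ) (v : ι → Bool) : ℝ :=
  ∏ i, bitWeight (p i) (v i)

theorem bitsWeight_nonneg {ι : Type*} [Fintype ι] {p : ι → ℝ} (h0 : ∀ i, 0 ≤ p i)
    (h1 : ∀ i, p i ≤ 1) (v : ι → Bool) : 0 ≤ bitsWeight p v :=
  Finset.prod_nonneg fun i _ => bitWeight_nonneg (h0 i) (h1 i) _

theorem sum_bitsWeight_mul_ind {ι : Type*} [Fintype ι] [DecidableEq ι] (p : ι → ℝ)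
    (ok : ι → Bool → Prop) :
    ∑ v, bitsWeight p v * ind (∀ i, ok i (v i)) =
      ∏ i, ∑ b, bitWeight (p i) b * ind (ok i b) := by
  rw [Finset.prod_univ_sum, Fintype.piFinset_univ]
  refine Finset.sum_congr rfl fun v _ => ?_
  rw [ind_forall, bitsWeight, Finset.prod_mul_distrib]

theorem sum_bitsWeight {ι : Type*} [Fintype ι] [DecidableEq ι] (p : ι → ℝ) :
    ∑ v, bitsWeight p v = 1 := by
  have := sum_bitsWeight_mul_ind p (fun _ _ => True)
  simpa [ind_of_true, bitWeight] using this

/-- Replacing independent bits by copies of bits that are otherwise not looked at, and have nearly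
the same bias, does not make any outcome much less likely. -/
theorem le_sum_bitsWeight_of_injective {I J : Type*} [Fintype I] [Fintype J] [DecidableEq I]
    [DecidableEq J] {p' : I → ℝ} {p : J → ℝ} {κ : ℝ} {σ : I → J} (hσ : Function.Injective σ)
    (hκ0 : 0 ≤ κ) (hκ1 : κ ≤ 1) (hp0 : ∀ j, 0 ≤ p j) (hp1 : ∀ j, p j ≤ 1)
    (hp'0 : ∀ i, 0 ≤ p' i) (hp'1 : ∀ i, p' i ≤ 1)
    (hκ : ∀ i b, (1 - κ) * bitWeight (p' i) b ≤ bitWeight (p (σ i)) b)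
    {okI : I → Bool → Prop} {okJ : J → Bool → Prop} {ZI : Finset I} {ZJ : Finset J}
    (hZI : ∀ i ∉ ZI, ∀ b, okI i b) (hZJ : ∀ j ∉ ZJ, ∀ b, okJ j b)
    (hdisj : ∀ i ∈ ZI, σ i ∉ ZJ) {q : ℕ} (hq : ZI.card ≤ q) :
    (1 - κ) ^ q * ((∑ w, bitsWeight p' w * ind (∀ i, okI i (w i))) *
      ∑ v, bitsWeight p v * ind (∀ j, okJ j (v j))) ≤
      ∑ v, bitsWeight p v * ind ((∀ j, okJ j (v j)) ∧ ∀ i, okI i (v (σ i))) := by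
  set F : J → ℝ := fun j => ∑ b, bitWeight (p j) b * ind (okJ j b) with hF
  set G' : I → ℝ := fun i => ∑ b, bitWeight (p' i) b * ind (okI i b) with hG'
  set G : J → ℝ := fun j => ∑ b, bitWeight (p j) b * ind (∀ i, σ i = j → okI i b) with hG
  have h1 : ∀ v : J → Bool, ((∀ j, okJ j (v j)) ∧ ∀ i, okI i (v (σ i))) ↔
      ∀ j, (okJ j (v j) ∧ ∀ i, σ i = j → okI i (v j)) := by
    intro v
    constructor
    · rintro ⟨h, h'⟩ j
      refine ⟨h j, ?_⟩
      rintro i rfl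
      exact h' i
    · intro h
      exact ⟨fun j => (h j).1, fun i => (h (σ i)).2 i rfl⟩
  have h2 : ∑ v, bitsWeight p v * ind ((∀ j, okJ j (v j)) ∧ ∀ i, okI i (v (σ i))) =
      ∏ j, F j * G j := by
    simp_rw [h1]
    rw [sum_bitsWeight_mul_ind p fun j b => okJ j b ∧ ∀ i, σ i = j → okI i b]
    refine Finset.prod_congr rfl fun j _ => ?_
    -- By `hdisj`, no bit of `v` is constrained both directly and through a copy, so one of the two
    -- factors is 1.
    by_cases hj : j ∈ ZJ
    · have : ∀ b, (∀ i, σ i = j → okI i b) := by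
        rintro b i rfl
        exact hZI i (fun hi => hdisj i hi hj) b
      have hGj : G j = 1 := by
        simp only [hG, ind_of_true (this _), mul_one, sum_bitWeight]
      rw [hGj, mul_one]
      simp only [ind_and, ind_of_true (this _), mul_one, hF]
    · have hFj : F j = 1 := by
        simp only [hF, ind_of_true (hZJ j hj _), mul_one, sum_bitWeight]
      rw [hFj, one_mul]
      simp only [ind_and, ind_of_true (hZJ j hj _), one_mul, hG]
  have h3 : ∏ j, G j = ∏ i, G (σ i) := by
    refine (Fintype.prod_of_injective σ hσ _ _ ?_ fun i => rfl).symm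
    intro j hj
    have : ∀ b, (∀ i, σ i = j → okI i b) := fun b i hi => (hj ⟨i, hi⟩).elim
    simp only [hG, ind_of_true (this _), mul_one, sum_bitWeight]
  have h4 : ∀ i, G (σ i) = ∑ b, bitWeight (p (σ i)) b * ind (okI i b) := by
    intro i
    have : ∀ b, (∀ i', σ i' = σ i → okI i' b) ↔ okI i b := by
      intro b
      refine ⟨fun h => h i rfl, fun h i' hi' => ?_⟩
      rwa [hσ hi']
    simp only [hG, this]
  have hG'0 : ∀ i, 0 ≤ G' i := fun i => Finset.sum_nonneg fun b _ =>
    mul_nonneg (bitWeight_nonneg (hp'0 i) (hp'1 i) b) (ind_nonneg _)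
  have hF0 : 0 ≤ ∏ j, F j := Finset.prod_nonneg fun j _ => Finset.sum_nonneg fun b _ =>
    mul_nonneg (bitWeight_nonneg (hp0 j) (hp1 j) b) (ind_nonneg _)
  -- Only the constrained bits pay a factor `1 - κ`; all the others contribute exactly 1 on both
  -- sides.
  have h5 : (1 - κ) ^ ZI.card * ∏ i, G' i ≤ ∏ i, G (σ i) := by
    rw [← Finset.prod_mul_prod_compl ZI G', ← Finset.prod_mul_prod_compl ZI (fun i => G (σ i)),
      ← mul_assoc]
    have h6 : ∏ i ∈ ZIᶜ, G' i = 1 := Finset.prod_eq_one fun i hi => by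
      simp only [hG', ind_of_true (hZI i (Finset.mem_compl.1 hi) _), mul_one, sum_bitWeight]
    have h7 : ∏ i ∈ ZIᶜ, G (σ i) = 1 := Finset.prod_eq_one fun i hi => by
      simp only [h4, ind_of_true (hZI i (Finset.mem_compl.1 hi) _), mul_one, sum_bitWeight]
    rw [h6, h7, mul_one, mul_one, ← Finset.prod_const, ← Finset.prod_mul_distrib]
    refine Finset.prod_le_prod (fun i _ => mul_nonneg (by linarith) (hG'0 i)) fun i _ => ?_
    rw [h4, hG', Finset.mul_sum]
    refine Finset.sum_le_sum fun b _ => ?_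
    rw [← mul_assoc]
    exact mul_le_mul_of_nonneg_right (hκ i b) (ind_nonneg _)
  rw [h2, Finset.prod_mul_distrib, h3, sum_bitsWeight_mul_ind, sum_bitsWeight_mul_ind]
  have h6 : (1 - κ) ^ q ≤ (1 - κ) ^ ZI.card :=
    pow_le_pow_of_le_one (by linarith) (by linarith) hq
  calc (1 - κ) ^ q * ((∏ i, G' i) * ∏ j, F j)
      ≤ (1 - κ) ^ ZI.card * ((∏ i, G' i) * ∏ j, F j) := mul_le_mul_of_nonneg_right h6
        (mul_nonneg (Finset.prod_nonneg fun i _ => hG'0 i) hF0)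
    _ = ((1 - κ) ^ ZI.card * ∏ i, G' i) * ∏ j, F j := by ring
    _ ≤ (∏ i, G (σ i)) * ∏ j, F j := mul_le_mul_of_nonneg_right h5 hF0
    _ = _ := mul_comm _ _

/-! ### Anticoncentration of the number of ones -/

/-- The left side grows by the factor `4 (2j+1)(2j+3) / (j+1)²`, which is below 16. -/
theorem centralBinom_sq_mul_le (j : ℕ) : j.centralBinom ^ 2 * (2 * j + 1) ≤ 16 ^ j := by
  induction j with
  | zero => simp
  | succ j ih =>
    have h := Nat.succ_mul_centralBinom_succ j
    have h1 : (j + 1) ^ 2 * ((j + 1).centralBinom ^ 2 * (2 * (j + 1) + 1)) =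
        (2 * (2 * j + 1) * j.centralBinom) ^ 2 * (2 * j + 3) := by
      rw [← h]; ring
    have h2 : (2 * (2 * j + 1) * j.centralBinom) ^ 2 * (2 * j + 3) =
        4 * (2 * j + 1) * (2 * j + 3) * (j.centralBinom ^ 2 * (2 * j + 1)) := by ring
    refine le_of_mul_le_mul_left (a := (j + 1) ^ 2) ?_ (pow_pos j.succ_pos 2)
    rw [h1, h2]
    calc _ ≤ 4 * (2 * j + 1) * (2 * j + 3) * 16 ^ j := Nat.mul_le_mul_left _ ih
      _ ≤ 16 * (j + 1) ^ 2 * 16 ^ j := Nat.mul_le_mul_right _ (by nlinarith)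
      _ = _ := by ring

/-- The middle coefficient is the largest one. For odd `m = 2j+1` it is half the central coefficient
of `2j+2`. -/
theorem choose_sq_mul_le (m k : ℕ) : m.choose k ^ 2 * (m + 1) ≤ 4 ^ m := by
  have hk : m.choose k ^ 2 * (m + 1) ≤ m.choose (m / 2) ^ 2 * (m + 1) := by
    gcongr
    exact Nat.choose_le_middle k m
  refine hk.trans ?_
  obtain ⟨j, rfl | rfl⟩ := Nat.even_or_odd' m
  · have := centralBinom_sq_mul_le j
    rw [Nat.centralBinom_eq_two_mul_choose] at this
    rw [pow_mul, Nat.mul_div_cancel_left j two_pos]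
    exact this
  · have := centralBinom_sq_mul_le (j + 1)
    rw [Nat.centralBinom_eq_two_mul_choose, show 2 * (j + 1) = 2 * j + 1 + 1 by ring,
      Nat.choose_succ_succ, Nat.choose_symm_half, pow_succ 16] at this
    rw [show (2 * j + 1) / 2 = j by omega, pow_succ 4, pow_mul]
    norm_num
    have h' : 4 * ((2 * j + 1).choose j ^ 2 * (2 * j + 1 + 1)) ≤ 16 ^ j * 16 :=
      le_trans (by nlinarith [sq_nonneg ((2 * j + 1).choose j)]) this
    omega

theorem choose_le_two_pow_mul {m b k : ℕ} (h : b ≤ m + 1) (hb : 0 < b) :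
    (m.choose k : ℝ) ≤ 2 ^ m * (1 / √b) := by
  have h1 : ((m.choose k : ℝ)) ^ 2 * b ≤ (2 ^ m) ^ 2 := by
    have := (Nat.mul_le_mul_left _ h).trans (choose_sq_mul_le m k)
    rw [← pow_mul, mul_comm m 2, pow_mul]
    norm_num
    exact_mod_cast this
  have hb' : (0 : ℝ) < √b := Real.sqrt_pos.2 (by exact_mod_cast hb)
  rw [mul_one_div, le_div_iff₀ hb']
  refine (sq_le_sq₀ (by positivity) (by positivity)).1 ?_
  rwa [mul_pow, Real.sq_sqrt (by positivity)]

/-- The number of `true`s in a string of bits. -/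
def trueCount {ι : Type*} [Fintype ι] (A : ι → Bool) : ℕ :=
  (Finset.univ.filter fun i => A i = true).card

theorem sum_ind_trueCount {ι : Type*} [Fintype ι] [DecidableEq ι] (k : ℕ) :
    ∑ A : ι → Bool, ind (trueCount A = k) = (Fintype.card ι).choose k := by
  rw [sum_ind, ← Finset.card_univ, ← Finset.card_powersetCard k Finset.univ]
  congr 1
  refine Finset.card_bij' (fun A _ => Finset.univ.filter fun i => A i = true)
    (fun s _ i => decide (i ∈ s)) ?_ ?_ ?_ ?_
  · intro A hA
    rw [Finset.mem_filter] at hA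
    exact Finset.mem_powersetCard.2 ⟨Finset.subset_univ _, hA.2⟩
  · intro s hs
    rw [Finset.mem_filter]
    simpa [trueCount] using hs
  · intro A _
    simp
  · intro s _
    simp

/-- Even when few of the bits are known, no value of the number of `true`s among uniformly random
bits is likely. -/
theorem sum_ind_trueCount_le {ι : Type*} [Fintype ι] [DecidableEq ι] {ok : ι → Bool → Prop}
    {Z : Finset ι} (hZ : ∀ i ∉ Z, ∀ b, ok i b) {b : ℕ} (hb : 0 < b)
    (hb' : b + Z.card ≤ Fintype.card ι + 1) (k : ℕ) :
    ∑ A : ι → Bool, ind ((∀ i, ok i (A i)) ∧ trueCount A = k) ≤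
      1 / √b * ∑ A : ι → Bool, ind (∀ i, ok i (A i)) := by
  -- Condition on the constrained bits `A₁`; the remaining bits stay uniform, and their count must
  -- equal `k` minus that of `A₁`.
  let e := Equiv.piEquivPiSubtypeProd (fun i => i ∈ Z) (fun _ : ι => Bool)
  rw [← e.symm.sum_comp, ← e.symm.sum_comp, Fintype.sum_prod_type, Fintype.sum_prod_type,
    Finset.mul_sum]
  refine Finset.sum_le_sum fun A₁ _ => ?_
  have h1 : ∀ A₂, (∀ i, ok i (e.symm (A₁, A₂) i)) ↔ ∀ i : {i // i ∈ Z}, ok i (A₁ i) := by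
    intro A₂
    constructor
    · intro h i
      have := h i
      simpa [e, Equiv.piEquivPiSubtypeProd] using this
    · intro h i
      by_cases hi : i ∈ Z
      · simpa [e, Equiv.piEquivPiSubtypeProd, hi] using h ⟨i, hi⟩
      · exact hZ i hi _
  have h2 : ∀ A₂, trueCount (e.symm (A₁, A₂)) = trueCount A₁ + trueCount A₂ := by
    intro A₂
    simp only [trueCount, Finset.card_filter]
    rw [← Fintype.sum_subtype_add_sum_subtype (fun i => i ∈ Z)]
    congr 1
    · refine Finset.sum_congr (by ext; simp) fun i _ => ?_
      simp [e, Equiv.piEquivPiSubtypeProd, i.2]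
    · refine Finset.sum_congr (by ext; simp) fun i _ => ?_
      simp [e, Equiv.piEquivPiSubtypeProd, i.2]
  simp only [h1, h2, ind_and]
  rw [← Finset.mul_sum, Finset.sum_const, nsmul_eq_mul, mul_comm _ (ind _), mul_left_comm]
  refine mul_le_mul_of_nonneg_left ?_ (ind_nonneg _)
  have hcard : Fintype.card {i // i ∉ Z} = Fintype.card ι - Z.card := by
    simp [Fintype.card_subtype_compl]
  calc ∑ A₂ : {i // i ∉ Z} → Bool, ind (trueCount A₁ + trueCount A₂ = k)
      ≤ ∑ A₂ : {i // i ∉ Z} → Bool, ind (trueCount A₂ = k - trueCount A₁) :=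
        Finset.sum_le_sum fun A₂ _ => ind_mono fun h => by omega
    _ = ((Fintype.card {i // i ∉ Z}).choose (k - trueCount A₁) : ℝ) := sum_ind_trueCount _
    _ ≤ 2 ^ (Fintype.card {i // i ∉ Z}) * (1 / √b) :=
        choose_le_two_pow_mul (by rw [hcard]; omega) hb
    _ = _ := by
        simp [mul_comm]

/-! ### Shifted copies against independent bits -/

/-- The random bits `A` shift the positions at which the bits `v` are copied. Few constraints on the
bits are almost as likely to be satisfied when `w` consists of copies of bits of `v` as when it
consists of independent bits. -/
theorem le_sum_shifted_bitsWeight {a L L' q b : ℕ} {p' : Fin L → ℝ} {p : Fin L' → ℝ} {κ : ℝ}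
    {σ : (Fin a → Bool) → Fin L → Fin L'}
    (hσ : ∀ A i, (σ A i).val = i.val + 2 * trueCount A)
    (hκ0 : 0 ≤ κ) (hκ1 : κ ≤ 1) (hp0 : ∀ j, 0 ≤ p j) (hp1 : ∀ j, p j ≤ 1)
    (hp'0 : ∀ i, 0 ≤ p' i) (hp'1 : ∀ i, p' i ≤ 1)
    (hκ : ∀ A i b, (1 - κ) * bitWeight (p' i) b ≤ bitWeight (p (σ A i)) b)
    {okA : Fin a → Bool → Prop} {okW : Fin L → Bool → Prop} {okV : Fin L' → Bool → Prop}
    {ZA : Finset (Fin a)} {ZW : Finset (Fin L)} {ZV : Finset (Fin L')}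
    (hZA : ∀ i ∉ ZA, ∀ b, okA i b) (hZW : ∀ i ∉ ZW, ∀ b, okW i b) (hZV : ∀ i ∉ ZV, ∀ b, okV i b)
    (hA : ZA.card ≤ q) (hW : ZW.card ≤ q) (hV : ZV.card ≤ q) (hb : 0 < b) (hbq : b + q ≤ a + 1) :
    (1 - κ) ^ q * (1 - q ^ 2 / √b) *
      ∑ A : Fin a → Bool, ∑ w, ∑ v, bitsWeight p' w * bitsWeight p v *
        ind ((∀ k, okA k (A k)) ∧ (∀ i, okW i (w i)) ∧ ∀ j, okV j (v j)) ≤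
      ∑ A : Fin a → Bool, ∑ v, bitsWeight p v *
        ind ((∀ k, okA k (A k)) ∧ (∀ i, okW i (v (σ A i))) ∧ ∀ j, okV j (v j)) := by
  set NW := ∑ w, bitsWeight p' w * ind (∀ i, okW i (w i)) with hNW
  set NV := ∑ v, bitsWeight p v * ind (∀ j, okV j (v j)) with hNV
  have hNW0 : 0 ≤ NW := Finset.sum_nonneg fun w _ =>
    mul_nonneg (bitsWeight_nonneg hp'0 hp'1 w) (ind_nonneg _)
  have hNV0 : 0 ≤ NV := Finset.sum_nonneg fun w _ =>
    mul_nonneg (bitsWeight_nonneg hp0 hp1 w) (ind_nonneg _)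
  have hinj : ∀ A, Function.Injective (σ A) := by
    intro A i i' h
    have := congrArg Fin.val h
    rw [hσ, hσ] at this
    exact Fin.ext (by omega)
  have hno : ∑ A : Fin a → Bool, ∑ w, ∑ v, bitsWeight p' w * bitsWeight p v *
        ind ((∀ k, okA k (A k)) ∧ (∀ i, okW i (w i)) ∧ ∀ j, okV j (v j)) =
      (∑ A : Fin a → Bool, ind (∀ k, okA k (A k))) * (NW * NV) := by
    rw [Finset.sum_mul]
    refine Finset.sum_congr rfl fun A _ => ?_
    rw [hNW, hNV, Finset.sum_mul_sum, Finset.mul_sum]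
    refine Finset.sum_congr rfl fun w _ => ?_
    rw [Finset.mul_sum]
    refine Finset.sum_congr rfl fun v _ => ?_
    rw [ind_and, ind_and]
    ring
  have hyes : ∀ A : Fin a → Bool, (1 - κ) ^ q * (NW * NV) *
      ind ((∀ k, okA k (A k)) ∧ ∀ i ∈ ZW, σ A i ∉ ZV) ≤ ∑ v, bitsWeight p v *
        ind ((∀ k, okA k (A k)) ∧ (∀ i, okW i (v (σ A i))) ∧ ∀ j, okV j (v j)) := by
    intro A
    by_cases h : (∀ k, okA k (A k)) ∧ ∀ i ∈ ZW, σ A i ∉ ZV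
    · rw [ind_of_true h, mul_one]
      refine (le_sum_bitsWeight_of_injective (hinj A) hκ0 hκ1 hp0 hp1 hp'0 hp'1 (hκ A) hZW hZV
        h.2 hW).trans (le_of_eq ?_)
      refine Finset.sum_congr rfl fun v _ => ?_
      rw [ind_and (∀ k, okA k (A k)), ind_of_true h.1, one_mul]
      rw [and_comm]
    · rw [ind_of_false h, mul_zero]
      exact Finset.sum_nonneg fun v _ => mul_nonneg (bitsWeight_nonneg hp0 hp1 v) (ind_nonneg _)
  -- A collision between a constrained `w i` and a constrained `v j` pins `trueCount A` to `(j - i)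
  -- / 2`. Truncated subtraction only adds harmless nonnegative terms for the other pairs.
  have hpt : ∀ A : Fin a → Bool, ind (∀ k, okA k (A k)) ≤
      ind ((∀ k, okA k (A k)) ∧ ∀ i ∈ ZW, σ A i ∉ ZV) +
      ∑ i ∈ ZW, ∑ j ∈ ZV, ind ((∀ k, okA k (A k)) ∧ trueCount A = (j.val - i.val) / 2) := by
    intro A
    have h0 : 0 ≤ ∑ i ∈ ZW, ∑ j ∈ ZV,
        ind ((∀ k, okA k (A k)) ∧ trueCount A = (j.val - i.val) / 2) :=
      Finset.sum_nonneg fun i _ => Finset.sum_nonneg fun j _ => ind_nonneg _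
    by_cases h : ∀ k, okA k (A k)
    · by_cases h' : ∀ i ∈ ZW, σ A i ∉ ZV
      · rw [ind_of_true h, ind_of_true ⟨h, h'⟩]
        linarith
      · push Not at h'
        obtain ⟨i, hi, hj⟩ := h'
        have h1 : ind ((∀ k, okA k (A k)) ∧ trueCount A = ((σ A i).val - i.val) / 2) = 1 := by
          refine ind_of_true ⟨h, ?_⟩
          rw [hσ]; omega
        have h2 := Finset.single_le_sum (f := fun j : Fin L' =>
          ind ((∀ k, okA k (A k)) ∧ trueCount A = (j.val - i.val) / 2))
          (fun j _ => ind_nonneg _) hj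
        have h3 := Finset.single_le_sum (f := fun i : Fin L => ∑ j ∈ ZV,
          ind ((∀ k, okA k (A k)) ∧ trueCount A = (j.val - i.val) / 2))
          (fun i _ => Finset.sum_nonneg fun j _ => ind_nonneg _) hi
        have h4 := ind_nonneg ((∀ k, okA k (A k)) ∧ ∀ i ∈ ZW, σ A i ∉ ZV)
        have h5 := ind_le_one (∀ k, okA k (A k))
        linarith
    · rw [ind_of_false h]
      have h4 := ind_nonneg ((∀ k, okA k (A k)) ∧ ∀ i ∈ ZW, σ A i ∉ ZV)
      linarith
  set NA := ∑ A : Fin a → Bool, ind (∀ k, okA k (A k)) with hNA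
  have hNA0 : 0 ≤ NA := Finset.sum_nonneg fun w _ => ind_nonneg _
  have hcount : (1 - q ^ 2 / √b) * NA ≤
      ∑ A : Fin a → Bool, ind ((∀ k, okA k (A k)) ∧ ∀ i ∈ ZW, σ A i ∉ ZV) := by
    have h1 := Finset.sum_le_sum fun A (_ : A ∈ Finset.univ) => hpt A
    rw [Finset.sum_add_distrib, Finset.sum_comm] at h1
    have h2 : ∑ i ∈ ZW, ∑ A : Fin a → Bool, ∑ j ∈ ZV,
        ind ((∀ k, okA k (A k)) ∧ trueCount A = (j.val - i.val) / 2) ≤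
        ∑ i ∈ ZW, ∑ j ∈ ZV, 1 / √b * NA := by
      refine Finset.sum_le_sum fun i _ => ?_
      rw [Finset.sum_comm]
      refine Finset.sum_le_sum fun j _ => ?_
      exact sum_ind_trueCount_le hZA hb (by rw [Fintype.card_fin]; omega) _
    have h3 : ∑ i ∈ ZW, ∑ j ∈ ZV, 1 / √(b : ℝ) * NA ≤ q ^ 2 / √b * NA := by
      simp only [Finset.sum_const, nsmul_eq_mul]
      have hc : (ZW.card : ℝ) * ZV.card ≤ q ^ 2 := by
        rw [sq]
        exact mul_le_mul (by exact_mod_cast hW) (by exact_mod_cast hV) (by positivity)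
          (by positivity)
      calc (ZW.card : ℝ) * (ZV.card * (1 / √(b : ℝ) * NA))
          = ZW.card * ZV.card * (1 / √(b : ℝ) * NA) := by ring
        _ ≤ q ^ 2 * (1 / √(b : ℝ) * NA) := mul_le_mul_of_nonneg_right hc (by positivity)
        _ = _ := by ring
    linarith
  rw [hno]
  calc (1 - κ) ^ q * (1 - q ^ 2 / √b) * (NA * (NW * NV))
      = (1 - κ) ^ q * (NW * NV) * ((1 - q ^ 2 / √b) * NA) := by ring
    _ ≤ (1 - κ) ^ q * (NW * NV) *
        ∑ A : Fin a → Bool, ind ((∀ k, okA k (A k)) ∧ ∀ i ∈ ZW, σ A i ∉ ZV) :=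
        mul_le_mul_of_nonneg_left hcount
          (mul_nonneg (pow_nonneg (by linarith) _) (mul_nonneg hNW0 hNV0))
    _ ≤ _ := by
        rw [Finset.mul_sum]
        exact Finset.sum_le_sum fun A _ => hyes A

/-! ### From fixed query sets to adaptive and randomized algorithms -/

/-- If a distribution gives every outcome of at most `q` queries nearly as much probability as
another one does, then so it does with the answers of an adaptive algorithm with `q` queries. -/
theorem QueryAlg.le_sum_run {n q : ℕ} {α Ω Ω' : Type} [Fintype α] [Fintype Ω] [Fintype Ω'] {c : ℝ}
    {μ : Ω → ℝ} {x : Ω → Fin n → α} {μ' : Ω' → ℝ} {x' : Ω' → Fin n → α}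
    (H : ∀ (Q : Finset (Fin n)) (τ : Fin n → α), Q.card ≤ q →
      c * ∑ ω, μ' ω * ind (∀ i ∈ Q, x' ω i = τ i) ≤ ∑ ω, μ ω * ind (∀ i ∈ Q, x ω i = τ i))
    (T : QueryAlg n α) (b : Bool) : ∀ (Q : Finset (Fin n)) (τ : Fin n → α),
    (∀ y : Fin n → α, (∀ i ∈ Q, y i = τ i) → Q.card + T.numQueries y ≤ q) →
      c * ∑ ω, μ' ω * ind ((∀ i ∈ Q, x' ω i = τ i) ∧ T.run (x' ω) = b) ≤
        ∑ ω, μ ω * ind ((∀ i ∈ Q, x ω i = τ i) ∧ T.run (x ω) = b) := by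
  classical
  induction T with
  | answer b' =>
    intro Q τ hQ
    by_cases h : b' = b
    · simpa [QueryAlg.run, h] using H Q τ (hQ τ fun _ _ => rfl)
    · simp [QueryAlg.run, h, ind_of_false]
  | query i next ih =>
    intro Q τ hQ
    -- A repeated query has its answer already fixed by `τ`, so `Q` does not grow. A fresh one
    -- splits the event according to the character read.
    by_cases hi : i ∈ Q
    · have h1 : ∀ y : Fin n → α, ((∀ i ∈ Q, y i = τ i) ∧ (QueryAlg.query i next).run y = b) ↔
          ((∀ i ∈ Q, y i = τ i) ∧ (next (τ i)).run y = b) := by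
        intro y
        refine and_congr_right fun h => ?_
        rw [QueryAlg.run, h i hi]
      simp only [h1]
      refine ih _ Q τ fun y hy => ?_
      have := hQ y hy
      rw [QueryAlg.numQueries, hy i hi] at this
      omega
    · have h1 : ∀ y : Fin n → α,
          ind ((∀ i ∈ Q, y i = τ i) ∧ (QueryAlg.query i next).run y = b) =
          ∑ s, ind ((∀ j ∈ insert i Q, y j = Function.update τ i s j) ∧
            (next s).run y = b) := by
        intro y
        have hup : ∀ s, (∀ j ∈ insert i Q, y j = Function.update τ i s j) ↔
            (y i = s ∧ ∀ j ∈ Q, y j = τ j) := by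
          intro s
          rw [Finset.forall_mem_insert, Function.update_self]
          refine and_congr_right fun _ => forall₂_congr fun j hj => ?_
          rw [Function.update_of_ne (ne_of_mem_of_not_mem hj hi)]
        rw [Finset.sum_eq_single (y i)]
        · congr 1
          rw [hup, QueryAlg.run]
          simp
        · intro s _ hs
          refine ind_of_false fun h => hs ?_
          exact ((hup s).1 h.1).1.symm
        · simp
      simp only [h1, Finset.mul_sum]
      rw [Finset.sum_comm, Finset.sum_comm (s := (Finset.univ : Finset Ω))]
      refine Finset.sum_le_sum fun s _ => ?_
      rw [← Finset.mul_sum]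
      refine ih s _ _ fun y hy => ?_
      rw [Finset.forall_mem_insert, Function.update_self] at hy
      have := hQ y fun j hj => by
        rw [hy.2 j hj, Function.update_of_ne (ne_of_mem_of_not_mem hj hi)]
      rw [QueryAlg.numQueries, hy.1] at this
      rw [Finset.card_insert_of_notMem hi]
      omega

theorem RandQueryAlg.prob_eq_tsum {n : ℕ} {α : Type} (A : RandQueryAlg n α) (x : Fin n → α)
    (b : Bool) : A.prob x b = ∑' T, (A T).toReal * ind (T.run x = b) := by
  rw [RandQueryAlg.prob, PMF.map_apply, ENNReal.tsum_toReal_eq]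
  · refine tsum_congr fun T => ?_
    by_cases h : T.run x = b
    · rw [ind_of_true h, if_pos h.symm, mul_one]
    · rw [ind_of_false h, if_neg (Ne.symm h)]
      simp
  · intro T
    split_ifs
    · exact PMF.apply_ne_top A T
    · simp

theorem RandQueryAlg.prob_nonneg {n : ℕ} {α : Type} (A : RandQueryAlg n α) (x : Fin n → α)
    (b : Bool) : 0 ≤ A.prob x b := ENNReal.toReal_nonneg

theorem RandQueryAlg.prob_true_add_prob_false {n : ℕ} {α : Type} (A : RandQueryAlg n α)
    (x : Fin n → α) : A.prob x true + A.prob x false = 1 := by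
  have h := PMF.tsum_coe (PMF.map (fun T : QueryAlg n α => T.run x) A)
  rw [tsum_bool] at h
  rw [RandQueryAlg.prob, RandQueryAlg.prob, ← ENNReal.toReal_add (PMF.apply_ne_top _ _)
    (PMF.apply_ne_top _ _), add_comm, h, ENNReal.toReal_one]

theorem RandQueryAlg.summable_weight {n : ℕ} {α : Type} (A : RandQueryAlg n α)
    (f : QueryAlg n α → ℝ) (C : ℝ) (hf : ∀ T, |f T| ≤ C) :
    Summable fun T => (A T).toReal * f T := by
  have h : Summable fun T => (A T).toReal :=
    ENNReal.summable_toReal (by rw [PMF.tsum_coe]; simp)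
  refine Summable.of_norm_bounded (h.mul_right C) fun T => ?_
  rw [norm_mul, Real.norm_of_nonneg ENNReal.toReal_nonneg, Real.norm_eq_abs]
  exact mul_le_mul_of_nonneg_left (hf T) ENNReal.toReal_nonneg

theorem RandQueryAlg.sum_mul_prob {n : ℕ} {α Ω : Type} [Fintype Ω] (A : RandQueryAlg n α)
    (μ : Ω → ℝ) (x : Ω → Fin n → α) (b : Bool) :
    ∑ ω, μ ω * A.prob (x ω) b =
      ∑' T, (A T).toReal * ∑ ω, μ ω * ind (T.run (x ω) = b) := by
  simp only [Finset.mul_sum]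
  rw [Summable.tsum_finsetSum]
  · refine Finset.sum_congr rfl fun ω _ => ?_
    rw [RandQueryAlg.prob_eq_tsum, ← tsum_mul_left]
    exact tsum_congr fun T => by ring
  · intro ω _
    refine A.summable_weight _ |μ ω| fun T => ?_
    rw [abs_mul, abs_of_nonneg (ind_nonneg _)]
    exact mul_le_of_le_one_right (abs_nonneg _) (ind_le_one _)

/-- Average the deterministic comparison over the random choices; trees outside the support have
weight zero, so the query bound is needed only on the support. -/
theorem RandQueryAlg.le_sum_prob {n q : ℕ} {α Ω Ω' : Type} [Fintype α] [Nonempty α] [Fintype Ω]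
    [Fintype Ω'] {c : ℝ}
    {μ : Ω → ℝ} {x : Ω → Fin n → α} {μ' : Ω' → ℝ} {x' : Ω' → Fin n → α}
    (H : ∀ (Q : Finset (Fin n)) (τ : Fin n → α), Q.card ≤ q →
      c * ∑ ω, μ' ω * ind (∀ i ∈ Q, x' ω i = τ i) ≤ ∑ ω, μ ω * ind (∀ i ∈ Q, x ω i = τ i))
    (A : RandQueryAlg n α) (hA : A.QueriesAtMost q) (b : Bool) :
    c * ∑ ω, μ' ω * A.prob (x' ω) b ≤ ∑ ω, μ ω * A.prob (x ω) b := by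
  have hsum : ∀ {Ω : Type} [Fintype Ω] (μ : Ω → ℝ) (x : Ω → Fin n → α),
      Summable fun T : QueryAlg n α => (A T).toReal * ∑ ω, μ ω * ind (T.run (x ω) = b) := by
    intro Ω _ μ x
    refine A.summable_weight _ (∑ ω, |μ ω|) fun T => ?_
    refine (Finset.abs_sum_le_sum_abs _ _).trans (Finset.sum_le_sum fun ω _ => ?_)
    rw [abs_mul, abs_of_nonneg (ind_nonneg _)]
    exact mul_le_of_le_one_right (abs_nonneg _) (ind_le_one _)
  rw [A.sum_mul_prob, A.sum_mul_prob, ← tsum_mul_left]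
  refine Summable.tsum_le_tsum (fun T => ?_) ((hsum μ' x').mul_left c) (hsum μ x)
  by_cases hT : T ∈ PMF.support A
  · rw [mul_left_comm]
    refine mul_le_mul_of_nonneg_left ?_ ENNReal.toReal_nonneg
    have := QueryAlg.le_sum_run H T b ∅ (fun _ => Classical.arbitrary α)
      (fun y _ => by simpa using hA T hT y)
    simpa using this
  · rw [PMF.mem_support_iff, not_not] at hT
    simp [hT]

/-! ### The hard inputs -/

/-- The parenthesis with the given shape and with type `0` or `1`. -/
def parenOfBits {m : ℕ} (hm : 2 ≤ m) (c : Bool × Bool) : Paren m :=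
  let t : Fin m := if c.2 then ⟨1, hm⟩ else ⟨0, by omega⟩
  if c.1 then Paren.opening t else Paren.closing t

@[simp]
theorem toBits_parenOfBits {m : ℕ} (hm : 2 ≤ m) (c : Bool × Bool) :
    (parenOfBits hm c).toBits = c := by
  obtain ⟨s, b⟩ := c
  cases s <;> cases b <;> simp [parenOfBits]

theorem IsBalanced.wrap_parenOfBits {m : ℕ} (hm : 2 ≤ m) (b : Bool) {z : List (Paren m)}
    (hz : IsBalanced z) :
    IsBalanced (parenOfBits hm (true, b) :: (z ++ [parenOfBits hm (false, b)])) := by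
  simpa [parenOfBits] using hz.wrap _

theorem IsBalanced.wrap_map {m : ℕ} (hm : 2 ≤ m) {z : List (Paren m)} (hz : IsBalanced z)
    (l : List Bool) :
    IsBalanced (l.map (fun b => parenOfBits hm (true, b)) ++ z ++
      (l.map fun b => parenOfBits hm (false, b)).reverse) := by
  induction l with
  | nil => simpa using hz
  | cons b l ih => simpa using ih.wrap_parenOfBits hm b

/-- Pairs that are either two opening parentheses or a balanced pair, followed by as many closing
parentheses as are needed. -/
theorem IsBalanced.wrap_pairs {m : ℕ} (hm : 2 ≤ m) {z : List (Paren m)} (hz : IsBalanced z)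
    (l : List Bool) :
    IsBalanced (l.flatMap (fun b => [parenOfBits hm (true, false), parenOfBits hm (b, false)]) ++
      z ++ List.replicate (2 * l.countP id) (parenOfBits hm (false, false))) := by
  induction l with
  | nil => simpa using hz
  | cons b l ih =>
    cases b with
    | true =>
      rw [List.countP_cons_of_pos (by rfl), mul_add, mul_one, List.replicate_add]
      simpa [List.replicate] using (ih.wrap_parenOfBits hm false).wrap_parenOfBits hm false
    | false =>
      rw [List.countP_cons_of_neg (by simp)]
      have h : IsBalanced [parenOfBits hm (true, false), parenOfBits hm (false, false)] := by
        simpa using IsBalanced.nil.wrap_parenOfBits hm false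
      simpa using h.append ih

theorem map_range_two_mul {β : Type*} (f : ℕ → β) (a : ℕ) :
    (List.range (2 * a)).map f = (List.range a).flatMap fun k => [f (2 * k), f (2 * k + 1)] := by
  induction a with
  | zero => rfl
  | succ a ih =>
    rw [mul_add, mul_one, List.range_succ, List.range_succ, List.range_succ, List.flatMap_append,
      ← ih]
    simp

/-- The bit which determines the character at position `p` of the hard inputs. -/
def hardSite (a L : ℕ) (p : Fin (2 * (L + 3 * a))) : Fin a ⊕ Fin L ⊕ Fin (L + 2 * a) :=
  if h1 : p.val < 2 * a then Sum.inl ⟨p.val / 2, by omega⟩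
  else if h2 : p.val < 2 * a + L then Sum.inr (Sum.inl ⟨p.val - 2 * a, by omega⟩)
  else if h3 : p.val < 2 * a + L + 2 * a then
    Sum.inl ⟨(p.val - (2 * a + L)) / 2, by omega⟩
  else Sum.inr (Sum.inr ⟨2 * (L + 3 * a) - 1 - p.val, by omega⟩)

/-- The character at position `p` of the hard inputs, as a function of the bit that determines
it. -/
def hardChar (a L p : ℕ) (b : Bool) : Bool × Bool :=
  if p < 2 * a then if p % 2 = 0 then (true, false) else (b, false)
  else if p < 2 * a + L then (true, b)
  else if p < 2 * a + L + 2 * a then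
    if (p - (2 * a + L)) % 2 = 0 then (true, false) else (!b, false)
  else (false, b)

/-- The hard inputs: pairs of parentheses of which `A` determines how many are balanced, opening
parentheses with types `w`, more pairs of parentheses, and closing parentheses with types `v`. -/
def hardInput {m : ℕ} (hm : 2 ≤ m) {a L : ℕ} (A : Fin a → Bool) (w : Fin L → Bool)
    (v : Fin (L + 2 * a) → Bool) (p : Fin (2 * (L + 3 * a))) : Paren m :=
  parenOfBits hm (hardChar a L p (Sum.elim A (Sum.elim w v) (hardSite a L p)))

/-- A string of bits, continued by `false`. -/
def extendBits {k : ℕ} (A : Fin k → Bool) (i : ℕ) : Bool := if h : i < k then A ⟨i, h⟩ else false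

theorem extendBits_of_lt {k : ℕ} (A : Fin k → Bool) {i : ℕ} (h : i < k) :
    extendBits A i = A ⟨i, h⟩ := by
  simp [extendBits, h]

theorem countP_extendBits {a : ℕ} (A : Fin a → Bool) :
    (List.range a).countP (extendBits A) = trueCount A := by
  have h := Nat.count_eq_card_filter_range (fun k => extendBits A k = true) a
  simp only [Nat.count, Bool.decide_eq_true] at h
  rw [h, trueCount, Finset.card_filter, Finset.card_filter, Finset.sum_range]
  simp [extendBits]

theorem trueCount_le {a : ℕ} (A : Fin a → Bool) : trueCount A ≤ a := by
  simpa [trueCount] using Finset.card_filter_le (Finset.univ : Finset (Fin a)) (fun i => A i = true)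

/-- The positionwise definition suits queries; the concatenated form suits the inductive definition
of balance. -/
theorem ofFn_hardInput {m : ℕ} (hm : 2 ≤ m) {a L : ℕ} (A : Fin a → Bool) (w : Fin L → Bool)
    (v : Fin (L + 2 * a) → Bool) :
    List.ofFn (hardInput hm A w v) =
      ((List.range a).map (extendBits A)).flatMap
        (fun b => [parenOfBits hm (true, false), parenOfBits hm (b, false)]) ++
      (((List.range L).map (extendBits w)).map (fun b => parenOfBits hm (true, b)) ++
      (((List.range a).map fun k => !extendBits A k).flatMap
        (fun b => [parenOfBits hm (true, false), parenOfBits hm (b, false)]) ++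
      (((List.range (L + 2 * a)).map (extendBits v)).map
        fun b => parenOfBits hm (false, b)).reverse)) := by
  have h1 : ∀ g : ℕ → Bool, ((List.range a).map g).flatMap
        (fun b => [parenOfBits hm (true, false), parenOfBits hm (b, false)]) =
      (List.range (2 * a)).map fun p =>
        parenOfBits hm (if p % 2 = 0 then (true, false) else (g (p / 2), false)) := by
    intro g
    rw [map_range_two_mul, List.flatMap_map]
    refine List.flatMap_congr fun k _ => ?_
    have : (2 * k + 1) / 2 = k := by omega
    simp [this]
  rw [h1, h1]
  apply List.ext_getElem
  · simp; omega
  · intro p hp _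
    simp only [List.length_ofFn] at hp
    simp only [List.getElem_ofFn, hardInput, List.getElem_append, List.length_map,
      List.length_range, List.getElem_map, List.getElem_range, List.getElem_reverse, hardChar,
      hardSite]
    by_cases c1 : p < 2 * a
    · simp [c1, extendBits_of_lt A (show p / 2 < a by omega)]
    · by_cases c2 : p < 2 * a + L
      · have c2' : p - 2 * a < L := by omega
        simp [c1, c2, c2', extendBits_of_lt w c2']
      · have c2' : ¬p - 2 * a < L := by omega
        by_cases c3 : p < 2 * a + L + 2 * a
        · have c3' : p - 2 * a - L < 2 * a := by omega
          have c4 : p - (2 * a + L) = p - 2 * a - L := by omega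
          simp [c1, c2, c2', c3, c3', c4,
            extendBits_of_lt A (show (p - 2 * a - L) / 2 < a by omega)]
        · have c3' : ¬p - 2 * a - L < 2 * a := by omega
          have c4 : L + 2 * a - 1 - (p - 2 * a - L - 2 * a) = 2 * (L + 3 * a) - 1 - p := by omega
          simp [c1, c2, c2', c3, c3', c4,
            extendBits_of_lt v (show 2 * (L + 3 * a) - 1 - p < L + 2 * a by omega)]

/-- The positions of the bits of which `w` consists in balanced inputs. -/
def shiftSite {a L : ℕ} (A : Fin a → Bool) (i : Fin L) : Fin (L + 2 * a) :=
  ⟨i.val + 2 * trueCount A, by have := trueCount_le A; omega⟩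

/-- The outer `2K` and inner `2 (a - K)` closing parentheses match pair-block parentheses of type 0,
and those between match `w`. The condition on `v` makes the former have type 0 whatever the value of
`K ≤ a`. -/
theorem isBalanced_hardInput {m : ℕ} (hm : 2 ≤ m) {a L : ℕ} (A : Fin a → Bool)
    (v : Fin (L + 2 * a) → Bool)
    (hv : ∀ j : Fin (L + 2 * a), j.val < 2 * a ∨ L ≤ j.val → v j = false) :
    IsBalanced (List.ofFn (hardInput hm A (fun i => v (shiftSite A i)) v)) := by
  rw [ofFn_hardInput]
  set K := trueCount A with hK
  have hKa : K ≤ a := trueCount_le A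
  have h0 : ((List.range a).map (extendBits A)).countP id = K := by
    rw [List.countP_map, Function.id_comp, countP_extendBits]
  have h1 : ((List.range a).map fun k => !extendBits A k).countP id = a - K := by
    have h := List.length_eq_countP_add_countP (extendBits A) (l := List.range a)
    rw [List.length_range, countP_extendBits] at h
    have h2 : (List.range a).countP (id ∘ fun k => !extendBits A k) =
        (List.range a).countP (fun k => decide ¬extendBits A k = true) := by
      refine List.countP_congr fun k _ => ?_
      simp
    rw [List.countP_map, h2]
    omega
  have hv' : ∀ j, j < 2 * a ∨ L ≤ j → extendBits v j = false := by
    intro j hj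
    by_cases h : j < L + 2 * a
    · rw [extendBits_of_lt v h]
      exact hv _ hj
    · simp [extendBits, h]
  have h2 : (((List.range (L + 2 * a)).map (extendBits v)).map
        fun b => parenOfBits hm (false, b)).reverse =
      List.replicate (2 * (a - K)) (parenOfBits hm (false, false)) ++
      ((((List.range L).map (extendBits fun i => v (shiftSite A i))).map
        fun b => parenOfBits hm (false, b)).reverse ++
      List.replicate (2 * K) (parenOfBits hm (false, false))) := by
    rw [← List.reverse_replicate (n := 2 * K), ← List.reverse_append,
      ← List.reverse_replicate (n := 2 * (a - K)), ← List.reverse_append]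
    congr 1
    apply List.ext_getElem
    · simp; omega
    · intro p hp _
      simp only [List.length_map, List.length_range] at hp
      simp only [List.getElem_append, List.getElem_map, List.getElem_range, List.length_append,
        List.length_replicate, List.getElem_replicate, List.length_map, List.length_range]
      by_cases c1 : p < 2 * K
      · have c2 : p < 2 * K + L := by omega
        simp [c1, c2, hv' p (by omega)]
      · by_cases c2 : p < 2 * K + L
        · have c3 : p - 2 * K < L := by omega
          simp only [c1, c2, dite_true, dite_false, extendBits_of_lt _ c3, extendBits_of_lt v hp]
          congr 4
          dsimp only
          omega
        · simp [c2, hv' p (by omega)]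
  rw [h2]
  -- Built from the inside out: the second pair block with its closing parentheses, the layer of
  -- `w`, the first pair block.
  have h3 := ((IsBalanced.nil.wrap_pairs hm ((List.range a).map fun k => !extendBits A k)).wrap_map
    hm ((List.range L).map (extendBits fun i => v (shiftSite A i)))).wrap_pairs hm
    ((List.range a).map (extendBits A))
  rw [h0, h1] at h3
  simpa only [List.append_nil, List.append_assoc] using h3

noncomputable instance instFintypeParen (m : ℕ) : Fintype (Paren m) :=
  Fintype.ofSurjective (fun c : Bool × Fin m =>
    if c.1 then Paren.opening c.2 else Paren.closing c.2) fun p => by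
      cases p with
      | opening t => exact ⟨(true, t), rfl⟩
      | closing t => exact ⟨(false, t), rfl⟩

/-! ### The slowly varying biases -/

/-- The biases of the types of the closing parentheses, which rise slowly from zero to one half and
then fall again. -/
noncomputable def hardBias (a L R r : ℕ) : ℝ := (min (min (r - 2 * a) (L - r)) R : ℕ) / (2 * R)

/-- The biases of the types of the opening parentheses at the positions of which the shift varies,
in the inputs that are far from balanced. -/
noncomputable def hardBias' (a L R i : ℕ) : ℝ :=
  (min (min (i - 2 * a) (L - (i + 2 * a))) R : ℕ) / (2 * R)

section Bias

variable {a L R : ℕ}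

theorem min_div_mem_Icc (hR : 0 < R) (x : ℕ) :
    0 ≤ ((min x R : ℕ) : ℝ) / (2 * R) ∧ ((min x R : ℕ) : ℝ) / (2 * R) ≤ 1 / 2 := by
  refine ⟨by positivity, ?_⟩
  have hR' : (0 : ℝ) < R := by exact_mod_cast hR
  rw [div_le_div_iff₀ (by positivity) (by norm_num)]
  have : ((min x R : ℕ) : ℝ) ≤ R := by exact_mod_cast min_le_right x R
  linarith

theorem hardBias_nonneg (hR : 0 < R) (r : ℕ) : 0 ≤ hardBias a L R r := (min_div_mem_Icc hR _).1

theorem hardBias_le_one (hR : 0 < R) (r : ℕ) : hardBias a L R r ≤ 1 :=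
  (min_div_mem_Icc hR _).2.trans (by norm_num)

theorem hardBias'_nonneg (hR : 0 < R) (r : ℕ) : 0 ≤ hardBias' a L R r := (min_div_mem_Icc hR _).1

theorem hardBias'_le_half (hR : 0 < R) (r : ℕ) : hardBias' a L R r ≤ 1 / 2 :=
  (min_div_mem_Icc hR _).2

theorem hardBias'_le_one (hR : 0 < R) (r : ℕ) : hardBias' a L R r ≤ 1 :=
  (hardBias'_le_half hR r).trans (by norm_num)

/-- `hardBias'` lies below every shifted `hardBias`, by at most `a / R`. For `true` nothing is lost;
for `false` the absolute loss `a / R` is a relative loss of at most `2a / R`, since `1 - hardBias' ≥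
1/2`. -/
theorem mul_bitWeight_hardBias'_le (hR : 0 < R) (i K : ℕ) (hK : K ≤ a) (b : Bool) :
    (1 - 2 * a / R) * bitWeight (hardBias' a L R i) b ≤
      bitWeight (hardBias a L R (i + 2 * K)) b := by
  have hR' : (0 : ℝ) < R := by exact_mod_cast hR
  have h0 := hardBias'_nonneg (a := a) (L := L) hR i
  have h1 := hardBias'_le_half (a := a) (L := L) hR i
  have hκ : (0 : ℝ) ≤ 2 * a / R := by positivity
  have hle : hardBias' a L R i ≤ hardBias a L R (i + 2 * K) := by
    unfold hardBias hardBias'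
    gcongr ?_ / _
    have : min (min (i - 2 * a) (L - (i + 2 * a))) R ≤
      min (min (i + 2 * K - 2 * a) (L - (i + 2 * K))) R := by omega
    exact_mod_cast this
  have hge : hardBias a L R (i + 2 * K) ≤ hardBias' a L R i + a / R := by
    unfold hardBias hardBias'
    have h2 : (a : ℝ) / R = (2 * a : ℕ) / (2 * R) := by
      push_cast
      field_simp
    rw [h2, ← add_div]
    gcongr ?_ / _
    have : min (min (i + 2 * K - 2 * a) (L - (i + 2 * K))) R ≤
      min (min (i - 2 * a) (L - (i + 2 * a))) R + 2 * a := by omega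
    exact_mod_cast this
  have h3 : (2 : ℝ) * a / R = 2 * (a / R) := by ring
  rw [h3] at hκ ⊢
  cases b with
  | true =>
    simp only [bitWeight, if_true]
    nlinarith
  | false =>
    simp only [bitWeight, Bool.false_eq_true, if_false]
    nlinarith

/-- Each fair bit contributes exactly `1/2`, any other bit at most 1. -/
theorem bitsWeight_le_half_pow {ι : Type*} [Fintype ι] [DecidableEq ι] {p : ι → ℝ}
    (h0 : ∀ i, 0 ≤ p i) (h1 : ∀ i, p i ≤ 1) {P : Finset ι} (hP : ∀ i ∈ P, p i = 1 / 2)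
    (v : ι → Bool) : bitsWeight p v ≤ (1 / 2) ^ P.card := by
  rw [bitsWeight, ← Finset.prod_mul_prod_compl P]
  have h2 : ∏ i ∈ P, bitWeight (p i) (v i) = (1 / 2) ^ P.card := by
    rw [← Finset.prod_const]
    refine Finset.prod_congr rfl fun i hi => ?_
    rw [hP i hi]
    cases v i <;> norm_num [bitWeight]
  rw [h2]
  refine mul_le_of_le_one_right (by positivity) ?_
  refine Finset.prod_le_one (fun i _ => bitWeight_nonneg (h0 i) (h1 i) _) fun i _ => ?_
  have := h0 i
  have := h1 i
  cases v i <;> simp [bitWeight] <;> linarith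

theorem bitsWeight_hardBias_le (hR : 0 < R) (v : Fin (L + 2 * a) → Bool) :
    bitsWeight (fun j : Fin (L + 2 * a) => hardBias a L R j) v ≤
      (1 / 2) ^ (L - R - (2 * a + R)) := by
  have hR' : (R : ℝ) ≠ 0 := by exact_mod_cast hR.ne'
  have h := bitsWeight_le_half_pow (p := fun j : Fin (L + 2 * a) => hardBias a L R j)
    (fun j => hardBias_nonneg hR j) (fun j => hardBias_le_one hR j)
    (P := Finset.attachFin (Finset.Ico (2 * a + R) (L - R)) fun j hj => by
      rw [Finset.mem_Ico] at hj; omega) (fun j hj => by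
      rw [Finset.mem_attachFin, Finset.mem_Ico] at hj
      rw [hardBias, show min (min (j.val - 2 * a) (L - j.val)) R = R by omega]
      field_simp) v
  rwa [Finset.card_attachFin, Nat.card_Ico] at h

theorem bitsWeight_hardBias'_le (hR : 0 < R) (w : Fin L → Bool) :
    bitsWeight (fun i : Fin L => hardBias' a L R i) w ≤
      (1 / 2) ^ (L - (2 * a + R) - (2 * a + R)) := by
  have hR' : (R : ℝ) ≠ 0 := by exact_mod_cast hR.ne'
  have h := bitsWeight_le_half_pow (p := fun j : Fin L => hardBias' a L R j)
    (fun j => hardBias'_nonneg hR j) (fun j => hardBias'_le_one hR j)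
    (P := Finset.attachFin (Finset.Ico (2 * a + R) (L - (2 * a + R))) fun j hj => by
      rw [Finset.mem_Ico] at hj; omega) (fun j hj => by
      rw [Finset.mem_attachFin, Finset.mem_Ico] at hj
      rw [hardBias', show min (min (j.val - 2 * a) (L - (j.val + 2 * a))) R = R by omega]
      field_simp) w
  rwa [Finset.card_attachFin, Nat.card_Ico] at h

end Bias

/-! ### Indistinguishability and farness of the hard inputs -/

/-- Every character depends on a single bit, so the outcome of a set of queries is a conjunction of
constraints on separate bits. -/
theorem hardInput_agrees_iff {m : ℕ} (hm : 2 ≤ m) {a L : ℕ} (Q : Finset (Fin (2 * (L + 3 * a))))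
    (τ : Fin (2 * (L + 3 * a)) → Paren m) (A : Fin a → Bool) (w : Fin L → Bool)
    (v : Fin (L + 2 * a) → Bool) :
    (∀ p ∈ Q, hardInput hm A w v p = τ p) ↔
      (∀ k, ∀ p ∈ Q, hardSite a L p = Sum.inl k →
        parenOfBits hm (hardChar a L p (A k)) = τ p) ∧
      (∀ i, ∀ p ∈ Q, hardSite a L p = Sum.inr (Sum.inl i) →
        parenOfBits hm (hardChar a L p (w i)) = τ p) ∧
      (∀ j, ∀ p ∈ Q, hardSite a L p = Sum.inr (Sum.inr j) →
        parenOfBits hm (hardChar a L p (v j)) = τ p) := by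
  constructor
  · intro h
    refine ⟨fun k p hp hs => ?_, fun k p hp hs => ?_, fun k p hp hs => ?_⟩ <;>
    · rw [← h p hp, hardInput, hs]
      rfl
  · rintro ⟨h1, h2, h3⟩ p hp
    rw [hardInput]
    rcases hs : hardSite a L p with k | i | j
    · exact h1 k p hp hs
    · exact h2 i p hp hs
    · exact h3 j p hp hs

/-- Few queries hardly distinguish the balanced hard inputs from the others. -/
theorem hardInput_indistinguishable {m : ℕ} (hm : 2 ≤ m) {a L R q b : ℕ} (hR : 0 < R)
    (haR : 2 * a ≤ R) (hb : 0 < b) (hbq : b + q ≤ a + 1) (Q : Finset (Fin (2 * (L + 3 * a))))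
    (τ : Fin (2 * (L + 3 * a)) → Paren m) (hQ : Q.card ≤ q) :
    (1 - 2 * a / R : ℝ) ^ q * (1 - q ^ 2 / √b) *
      ∑ ω : (Fin a → Bool) × (Fin L → Bool) × (Fin (L + 2 * a) → Bool),
        bitsWeight (fun i : Fin L => hardBias' a L R i) ω.2.1 *
          bitsWeight (fun j : Fin (L + 2 * a) => hardBias a L R j) ω.2.2 *
        ind (∀ p ∈ Q, hardInput hm ω.1 ω.2.1 ω.2.2 p = τ p) ≤
      ∑ ω : (Fin a → Bool) × (Fin (L + 2 * a) → Bool),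
        bitsWeight (fun j : Fin (L + 2 * a) => hardBias a L R j) ω.2 *
        ind (∀ p ∈ Q, hardInput hm ω.1 (fun i => ω.2 (shiftSite ω.1 i)) ω.2 p = τ p) := by
  have hR' : (0 : ℝ) < R := by exact_mod_cast hR
  simp only [hardInput_agrees_iff, Fintype.sum_prod_type]
  have hcard : ∀ {β : Type} [Fintype β] (f : β → Fin a ⊕ Fin L ⊕ Fin (L + 2 * a)),
      Function.Injective f →
      (Finset.univ.filter fun k => f k ∈ Q.image (hardSite a L)).card ≤ q := by
    intro β _ f hf
    refine (Finset.card_le_card_of_injOn (t := Q.image (hardSite a L)) f ?_ hf.injOn).trans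
      (Finset.card_image_le.trans hQ)
    intro k hk
    simpa using hk
  have hok : ∀ {β : Type} [Fintype β] (f : β → Fin a ⊕ Fin L ⊕ Fin (L + 2 * a)),
      ∀ k ∉ (Finset.univ.filter fun k => f k ∈ Q.image (hardSite a L)), ∀ b : Bool,
      ∀ p ∈ Q, hardSite a L p = f k → parenOfBits hm (hardChar a L p b) = τ p := by
    intro β _ f k hk b p hp hs
    refine (hk ?_).elim
    rw [Finset.mem_filter]
    exact ⟨Finset.mem_univ _, Finset.mem_image.2 ⟨p, hp, hs⟩⟩
  exact le_sum_shifted_bitsWeight (σ := shiftSite)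
    (p' := fun i : Fin L => hardBias' a L R i)
    (p := fun j : Fin (L + 2 * a) => hardBias a L R j) (κ := 2 * a / R)
    (okA := fun k b => ∀ p ∈ Q, hardSite a L p = Sum.inl k →
      parenOfBits hm (hardChar a L p b) = τ p)
    (okW := fun i b => ∀ p ∈ Q, hardSite a L p = Sum.inr (Sum.inl i) →
      parenOfBits hm (hardChar a L p b) = τ p)
    (okV := fun j b => ∀ p ∈ Q, hardSite a L p = Sum.inr (Sum.inr j) →
      parenOfBits hm (hardChar a L p b) = τ p)
    (fun A i => rfl) (by positivity)
    (by rw [div_le_one hR']; exact_mod_cast haR)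
    (fun j => hardBias_nonneg hR j) (fun j => hardBias_le_one hR j)
    (fun j => hardBias'_nonneg hR j) (fun j => hardBias'_le_one hR j)
    (fun A i b => mul_bitWeight_hardBias'_le hR i _ (trueCount_le A) b)
    (hok Sum.inl) (hok (fun i => Sum.inr (Sum.inl i))) (hok (fun j => Sum.inr (Sum.inr j)))
    (hcard _ Sum.inl_injective) (hcard _ (Sum.inr_injective.comp Sum.inl_injective))
    (hcard _ (Sum.inr_injective.comp Sum.inr_injective)) hb hbq

/-- The types of the hard inputs. -/
def hardTypes {a L : ℕ} (A : Fin a → Bool) (ω : (Fin L → Bool) × (Fin (L + 2 * a) → Bool))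
    (p : Fin (2 * (L + 3 * a))) : Bool :=
  (hardChar a L p (Sum.elim A (Sum.elim ω.1 ω.2) (hardSite a L p))).2

theorem hardTypes_injective {a L : ℕ} (A : Fin a → Bool) :
    Function.Injective (hardTypes (L := L) A) := by
  intro ω ω' h
  refine Prod.ext (funext fun i => ?_) (funext fun j => ?_)
  · have h1 := congrFun h ⟨2 * a + i.val, by omega⟩
    simpa [hardTypes, hardChar, hardSite] using h1
  · have h1 := congrFun h ⟨2 * (L + 3 * a) - 1 - j.val, by omega⟩
    have c1 : ¬2 * (L + 3 * a) - 1 - j.val < 2 * a := by omega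
    have c2 : ¬2 * (L + 3 * a) - 1 - j.val < 2 * a + L := by omega
    have c3 : ¬2 * (L + 3 * a) - 1 - j.val < 2 * a + L + 2 * a := by omega
    have c4 : 2 * (L + 3 * a) - 1 - (2 * (L + 3 * a) - 1 - j.val) = j.val := by omega
    simpa only [hardTypes, hardChar, hardSite, c1, c2, c3, c4, if_false, dite_false,
      Sum.elim_inr] using h1

/-- The shape depends on `A` alone, so fixing `A` leaves one shape for `card_close_le`. -/
theorem toBits_hardInput {m : ℕ} (hm : 2 ≤ m) {a L : ℕ} (A : Fin a → Bool)
    (ω : (Fin L → Bool) × (Fin (L + 2 * a) → Bool)) (p : Fin (2 * (L + 3 * a))) :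
    (hardInput hm A ω.1 ω.2 p).toBits =
      ((hardChar a L p (Sum.elim A (fun _ => false) (hardSite a L p))).1, hardTypes A ω p) := by
  rw [hardInput, toBits_parenOfBits, hardTypes]
  refine Prod.ext ?_ rfl
  simp only [hardChar, hardSite]
  split_ifs <;> simp

/-- With independent types, few of the hard inputs are close to balanced. -/
theorem sum_hardInput_not_isFar_le {m : ℕ} (hm : 2 ≤ m) {a L R : ℕ} (hR : 0 < R)
    (A : Fin a → Bool) :
    ∑ ω : (Fin L → Bool) × (Fin (L + 2 * a) → Bool),
      bitsWeight (fun i : Fin L => hardBias' a L R i) ω.1 *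
        bitsWeight (fun j : Fin (L + 2 * a) => hardBias a L R j) ω.2 *
        ind (¬IsFar (1 / 1000) (hardInput hm A ω.1 ω.2) (stringsOfLength (dyckLanguage m) _)) ≤
      (1 / 2) ^ (L - (2 * a + R) - (2 * a + R) + (L - R - (2 * a + R))) *
        (2 ^ (L + 3 * a) * (19 / 16) ^ (2 * (L + 3 * a)) * 16 ^ (2 * (L + 3 * a) / 1000)) := by
  classical
  set d := 2 * (L + 3 * a) / 1000
  set S : Fin (2 * (L + 3 * a)) → Bool := fun p =>
    (hardChar a L p (Sum.elim A (fun _ => false) (hardSite a L p))).1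
  have hclose : ∀ ω : (Fin L → Bool) × (Fin (L + 2 * a) → Bool),
      ¬IsFar (1 / 1000) (hardInput hm A ω.1 ω.2) (stringsOfLength (dyckLanguage m) _) →
      ∃ y : Fin (2 * (L + 3 * a)) → Paren m, IsBalanced (List.ofFn y) ∧
        hammingDist (fun i => (S i, hardTypes A ω i)) (fun i => (y i).toBits) ≤ d := by
    intro ω h
    simp only [IsFar, not_forall, not_lt] at h
    obtain ⟨y, hy, hd⟩ := h
    refine ⟨y, hy, ?_⟩
    have h1 : (fun i => (S i, hardTypes A ω i)) =
        fun i => (hardInput hm A ω.1 ω.2 i).toBits := by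
      funext i
      rw [toBits_hardInput]
    rw [h1]
    -- Identifying all nonzero types cannot increase the distance; this makes the bound uniform in
    -- `m`.
    refine (hammingDist_comp_le_hammingDist (fun _ => Paren.toBits)).trans ?_
    rw [Nat.le_div_iff_mul_le (by norm_num)]
    have : (hammingDist (hardInput hm A ω.1 ω.2) y : ℝ) * 1000 ≤ (2 * (L + 3 * a) : ℕ) := by
      linarith
    exact_mod_cast this
  -- Largest probability of a single outcome, times the number of close outcomes.
  refine (Finset.sum_le_sum fun ω _ => mul_le_mul_of_nonneg_right
    (mul_le_mul (bitsWeight_hardBias'_le hR ω.1) (bitsWeight_hardBias_le hR ω.2)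
      (bitsWeight_nonneg (fun _ => hardBias_nonneg hR _) (fun _ => hardBias_le_one hR _) _)
      (by positivity)) (ind_nonneg _)).trans ?_
  rw [← Finset.mul_sum, ← pow_add]
  refine mul_le_mul_of_nonneg_left ?_ (by positivity)
  set P : (Fin L → Bool) × (Fin (L + 2 * a) → Bool) → Prop := fun ω =>
    ¬IsFar (1 / 1000) (hardInput hm A ω.1 ω.2) (stringsOfLength (dyckLanguage m) _) with hP
  have h2 : ∑ ω, ind (P ω) = (((Finset.univ.filter P).image (hardTypes A)).card : ℝ) := by
    rw [Finset.card_image_of_injective _ (hardTypes_injective A), sum_ind]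
  rw [h2]
  refine card_close_le m d S _ fun T hT => ?_
  obtain ⟨ω, hω, rfl⟩ := Finset.mem_image.1 hT
  exact hclose ω (Finset.mem_filter.1 hω).2

/-- The bias is zero at every index below `2a` or at least `L`, so a `v` of nonzero weight vanishes
there. -/
theorem hardInput_mem_stringsOfLength {m : ℕ} (hm : 2 ≤ m) {a L R : ℕ}
    (A : Fin a → Bool) (v : Fin (L + 2 * a) → Bool)
    (hv : bitsWeight (fun j : Fin (L + 2 * a) => hardBias a L R j) v ≠ 0) :
    hardInput hm A (fun i => v (shiftSite A i)) v ∈ stringsOfLength (dyckLanguage m) _ := by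
  refine isBalanced_hardInput hm A v fun j hj => ?_
  by_contra h
  refine hv (Finset.prod_eq_zero (Finset.mem_univ j) ?_)
  rw [Bool.not_eq_false] at h
  have h0 : min (min (j.val - 2 * a) (L - j.val)) R = 0 := by omega
  simp only [h, hardBias, h0, bitWeight, if_true, Nat.cast_zero, zero_div]

/-- Compare average rejection probabilities: at most `η` on the balanced distribution, at least `1 -
η` times the probability of being far on the other. The uniform weight of `A` is left unnormalized,
whence the factor `2 ^ a` in the proof. -/
theorem RandQueryAlg.IsTester.mul_le {m : ℕ} (hm : 2 ≤ m) {a L R q b : ℕ} {η : ℝ} (hη : η ≤ 1) (hR : 0 < R)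
    (haR : 2 * a ≤ R) (hb : 0 < b) (hbq : b + q ≤ a + 1) (hq : (q : ℝ) ^ 2 / √b ≤ 1)
    (T : RandQueryAlg (2 * (L + 3 * a)) (Paren m))
    (hT : T.IsTester (1 / 1000) η (dyckLanguage m)) (hTq : T.QueriesAtMost q) :
    (1 - 2 * a / R : ℝ) ^ q * (1 - q ^ 2 / √b) * ((1 - η) *
      (1 - (1 / 2) ^ (L - (2 * a + R) - (2 * a + R) + (L - R - (2 * a + R))) *
        (2 ^ (L + 3 * a) * (19 / 16) ^ (2 * (L + 3 * a)) * 16 ^ (2 * (L + 3 * a) / 1000)))) ≤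
      η := by
  set f : ℝ := (1 / 2) ^ (L - (2 * a + R) - (2 * a + R) + (L - R - (2 * a + R))) *
        (2 ^ (L + 3 * a) * (19 / 16) ^ (2 * (L + 3 * a)) * 16 ^ (2 * (L + 3 * a) / 1000)) with hf
  have hR' : (0 : ℝ) < R := by exact_mod_cast hR
  have hκ : 2 * (a : ℝ) / R ≤ 1 := by rw [div_le_one hR']; exact_mod_cast haR
  have : Nonempty (Paren m) := ⟨Paren.opening ⟨0, by omega⟩⟩
  have main := RandQueryAlg.le_sum_prob
    (hardInput_indistinguishable (L := L) hm hR haR hb hbq) T hTq false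
  have hyes : ∑ ω : (Fin a → Bool) × (Fin (L + 2 * a) → Bool),
        bitsWeight (fun j : Fin (L + 2 * a) => hardBias a L R j) ω.2 *
        T.prob (hardInput hm ω.1 (fun i => ω.2 (shiftSite ω.1 i)) ω.2) false ≤ 2 ^ a * η := by
    calc _ ≤ ∑ ω : (Fin a → Bool) × (Fin (L + 2 * a) → Bool),
          bitsWeight (fun j : Fin (L + 2 * a) => hardBias a L R j) ω.2 * η := by
          refine Finset.sum_le_sum fun ω _ => ?_
          by_cases h : bitsWeight (fun j : Fin (L + 2 * a) => hardBias a L R j) ω.2 = 0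
          · rw [h, zero_mul, zero_mul]
          · refine mul_le_mul_of_nonneg_left ?_
              (bitsWeight_nonneg (fun _ => hardBias_nonneg hR _) (fun _ => hardBias_le_one hR _) _)
            have h1 := hT.1 _ (hardInput_mem_stringsOfLength hm ω.1 ω.2 h)
            have h2 := T.prob_true_add_prob_false
              (hardInput hm ω.1 (fun i => ω.2 (shiftSite ω.1 i)) ω.2)
            linarith
      _ = _ := by
          rw [Fintype.sum_prod_type]
          simp [← Finset.sum_mul, sum_bitsWeight]
  have hno : 2 ^ a * ((1 - η) * (1 - f)) ≤
      ∑ ω : (Fin a → Bool) × (Fin L → Bool) × (Fin (L + 2 * a) → Bool),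
        bitsWeight (fun i : Fin L => hardBias' a L R i) ω.2.1 *
          bitsWeight (fun j : Fin (L + 2 * a) => hardBias a L R j) ω.2.2 *
        T.prob (hardInput hm ω.1 ω.2.1 ω.2.2) false := by
    rw [Fintype.sum_prod_type]
    calc (2 : ℝ) ^ a * ((1 - η) * (1 - f)) = ∑ A : Fin a → Bool, (1 - η) * (1 - f) := by simp
      _ ≤ _ := by
        refine Finset.sum_le_sum fun A _ => ?_
        have hw : ∑ ω : (Fin L → Bool) × (Fin (L + 2 * a) → Bool),
            bitsWeight (fun i : Fin L => hardBias' a L R i) ω.1 *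
            bitsWeight (fun j : Fin (L + 2 * a) => hardBias a L R j) ω.2 = 1 := by
          rw [Fintype.sum_prod_type]
          simp [← Finset.mul_sum, sum_bitsWeight]
        have hfar := sum_hardInput_not_isFar_le (L := L) hm hR A
        rw [← hf] at hfar
        calc (1 - η) * (1 - f) ≤ (1 - η) * (_ - _) := by
              refine mul_le_mul_of_nonneg_left ?_ (by linarith)
              exact sub_le_sub hw.ge hfar
          _ = ∑ ω : (Fin L → Bool) × (Fin (L + 2 * a) → Bool),
              bitsWeight (fun i : Fin L => hardBias' a L R i) ω.1 *
              bitsWeight (fun j : Fin (L + 2 * a) => hardBias a L R j) ω.2 *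
              ((1 - η) * (1 - ind (¬IsFar (1 / 1000) (hardInput hm A ω.1 ω.2)
                (stringsOfLength (dyckLanguage m) _)))) := by
              rw [← Finset.sum_sub_distrib, Finset.mul_sum]
              exact Finset.sum_congr rfl fun ω _ => by ring
          _ ≤ _ := by
              refine Finset.sum_le_sum fun ω _ => mul_le_mul_of_nonneg_left ?_ (mul_nonneg
                (bitsWeight_nonneg (fun _ => hardBias'_nonneg hR _)
                  (fun _ => hardBias'_le_one hR _) _)
                (bitsWeight_nonneg (fun _ => hardBias_nonneg hR _)
                  (fun _ => hardBias_le_one hR _) _))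
              by_cases h : IsFar (1 / 1000) (hardInput hm A ω.1 ω.2)
                (stringsOfLength (dyckLanguage m) _)
              · rw [ind_of_false (not_not.2 h), sub_zero, mul_one]
                exact hT.2 _ h
              · rw [ind_of_true h, sub_self, mul_zero]
                exact T.prob_nonneg _ _
  have hc : 0 ≤ (1 - 2 * a / R : ℝ) ^ q * (1 - q ^ 2 / √b) :=
    mul_nonneg (pow_nonneg (by linarith) _) (by linarith)
  have h2 := (mul_le_mul_of_nonneg_left hno hc).trans (main.trans hyes)
  have h3 : (0 : ℝ) < 2 ^ a := by positivity
  refine le_of_mul_le_mul_left ?_ h3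
  calc _ = _ := by ring
    _ ≤ _ := h2

/-! ### Choice of parameters and conclusion -/

theorem exists_pow_five_le (h : ℕ) : ∃ s : ℕ, s ^ 5 ≤ h ∧ h < (s + 1) ^ 5 := by
  induction h with
  | zero => exact ⟨0, by norm_num⟩
  | succ h ih =>
    obtain ⟨s, h1, h2⟩ := ih
    by_cases h3 : h + 1 < (s + 1) ^ 5
    · exact ⟨s, by omega, h3⟩
    · refine ⟨s + 1, by omega, ?_⟩
      have : (s + 1) ^ 5 < (s + 1 + 1) ^ 5 := Nat.pow_lt_pow_left (by omega) (by norm_num)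
      omega

/-- Up to the deficit `e` of fair bits and the radius `d`, the product is at most `(2 · (3/2) / 4) ^
h = (3/4) ^ h`, using `(19/16)² < 3/2`. Four factors `3/4` absorb one factor 2, as `2 · (3/4) ^ 4 =
81/128`. -/
theorem half_pow_mul_le {h e k N d : ℕ} (hN : 2 * h ≤ N + e) (hu : e + 4 * d ≤ k)
    (hk : 4 * k ≤ h) :
    (1 / 2 : ℝ) ^ N * (2 ^ h * (19 / 16) ^ (2 * h) * 16 ^ d) ≤ (81 / 128) ^ k := by
  have h1 : (1 / 2 : ℝ) ^ N ≤ (1 / 4) ^ h * 2 ^ e := by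
    calc (1 / 2 : ℝ) ^ N = (1 / 2) ^ (N + e) * 2 ^ e := by
          rw [pow_add, mul_assoc, ← mul_pow]; norm_num
      _ ≤ (1 / 2) ^ (2 * h) * 2 ^ e := by
          gcongr ?_ * _
          exact pow_le_pow_of_le_one (by norm_num) (by norm_num) hN
      _ = _ := by rw [pow_mul]; norm_num
  have h2 : ((19 : ℝ) / 16) ^ (2 * h) ≤ (3 / 2) ^ h := by
    rw [pow_mul]
    exact pow_le_pow_left₀ (by norm_num) (by norm_num) _
  calc (1 / 2 : ℝ) ^ N * (2 ^ h * (19 / 16) ^ (2 * h) * 16 ^ d)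
      ≤ (1 / 4) ^ h * 2 ^ e * (2 ^ h * (3 / 2) ^ h * 16 ^ d) := by gcongr
    _ = (3 / 4) ^ h * 2 ^ (e + 4 * d) := by
        have h3 : (16 : ℝ) ^ d = 2 ^ (4 * d) := by rw [pow_mul]; norm_num
        have h4 : (3 / 4 : ℝ) ^ h = (1 / 4) ^ h * (2 ^ h * (3 / 2) ^ h) := by
          rw [← mul_pow, ← mul_pow]; norm_num
        rw [h3, h4, pow_add]
        ring
    _ ≤ (3 / 4) ^ (4 * k) * 2 ^ k := by
        refine mul_le_mul (pow_le_pow_of_le_one (by norm_num) (by norm_num) hk)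
          (pow_le_pow_right₀ (by norm_num) hu) (by positivity) (by positivity)
    _ = _ := by
        rw [pow_mul, ← mul_pow]
        norm_num

theorem rpow_one_fifth_le {h s : ℕ} (hs : 1 ≤ s) (hh : h < (s + 1) ^ 5) :
    ((2 * h : ℕ) : ℝ) ^ (1 / 5 : ℝ) ≤ 4 * s := by
  have h1 : ((2 * h : ℕ) : ℝ) ≤ (4 * s : ℝ) ^ (5 : ℕ) := by
    have h2 : 2 * h ≤ (4 * s) ^ 5 := by
      calc 2 * h ≤ 2 ^ 5 * (s + 1) ^ 5 := by omega
        _ = (2 * (s + 1)) ^ 5 := by rw [mul_pow]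
        _ ≤ (4 * s) ^ 5 := Nat.pow_le_pow_left (by omega) 5
    exact_mod_cast h2
  calc ((2 * h : ℕ) : ℝ) ^ (1 / 5 : ℝ) ≤ ((4 * s : ℝ) ^ (5 : ℕ)) ^ (1 / 5 : ℝ) := by gcongr
    _ = 4 * s := by
        rw [show (1 / 5 : ℝ) = ((5 : ℕ) : ℝ)⁻¹ by norm_num]
        exact Real.pow_rpow_inv_natCast (by positivity) (by norm_num)

theorem mainTheorem2 :
    ∃ ε : ℝ, 0 < ε ∧ ∀ η : ℝ, 0 ≤ η → η < 1 / 2 →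
      ∃ c : ℝ, 0 < c ∧ ∃ N : ℕ, ∀ m : ℕ, 2 ≤ m → ∀ n : ℕ, N ≤ n → Even n →
        ∀ A : RandQueryAlg n (Paren m), RandQueryAlg.IsTester A ε η (dyckLanguage m) →
          ∀ q : ℕ, RandQueryAlg.QueriesAtMost A q → c * (n : ℝ) ^ (1 / 5 : ℝ) ≤ (q : ℝ) := by
  refine ⟨1 / 1000, by norm_num, fun η hη0 hη => ?_⟩
  set γ := 1 - 2 * η with hγ
  have hγ0 : 0 < γ := by linarith
  have hγ1 : γ ≤ 1 := by linarith
  obtain ⟨U, hU⟩ := exists_pow_lt_of_lt_one (show 0 < γ / 8 by linarith)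
    (show (81 / 128 : ℝ) < 1 by norm_num)
  -- `16384 = 4 · 4096`, where 4 comes from `rpow_one_fifth_le`. The threshold ensures `s ≥ 400` and
  -- `h / 4 ≥ U`.
  refine ⟨γ / 16384, by linarith, 2 * (400 ^ 5 + 4 * U), fun m hm n hn heven T hT q hTq => ?_⟩
  obtain ⟨h, rfl⟩ := heven.two_dvd
  by_contra! hlt
  obtain ⟨s, hs1, hs2⟩ := exists_pow_five_le h
  have hs : 400 ≤ s := by
    by_contra! hs
    have := Nat.pow_le_pow_left (show s + 1 ≤ 400 by omega) 5
    omega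
  have hs0 : (400 : ℝ) ≤ s := by exact_mod_cast hs
  have hs4 : 400 * s ^ 4 ≤ h := by
    calc 400 * s ^ 4 ≤ s * s ^ 4 := Nat.mul_le_mul_right _ hs
      _ = s ^ 5 := by ring
      _ ≤ h := hs1
  have hs40 : 1 ≤ s ^ 4 := Nat.one_le_pow _ _ (by omega)
  have hqs : (q : ℝ) ≤ γ / 4096 * s := by
    have := mul_le_mul_of_nonneg_left (rpow_one_fifth_le (by omega) hs2)
      (show 0 ≤ γ / 16384 by linarith)
    linarith
  have hq4 : q ≤ s ^ 4 := by
    have h1 : q ≤ s := by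
      have : (q : ℝ) ≤ s := by nlinarith
      exact_mod_cast this
    exact h1.trans (Nat.le_self_pow (by norm_num) s)
  have hsqrt : √((s ^ 4 : ℕ) : ℝ) = (s : ℝ) ^ 2 := by
    rw [show ((s ^ 4 : ℕ) : ℝ) = ((s : ℝ) ^ 2) ^ 2 by push_cast; ring]
    exact Real.sqrt_sq (by positivity)
  have hmatch : (q : ℝ) ^ 2 / √((s ^ 4 : ℕ) : ℝ) ≤ γ / 16 := by
    rw [hsqrt, div_le_iff₀ (by positivity)]
    calc (q : ℝ) ^ 2 ≤ (γ / 4096 * s) ^ 2 := by gcongr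
      _ = γ / 4096 * (γ / 4096) * s ^ 2 := by ring
      _ ≤ γ / 16 * s ^ 2 := by
          gcongr
          nlinarith
  set R := h / 32 with hR
  have hRs : (s : ℝ) ^ 5 ≤ 64 * R := by
    have : s ^ 5 ≤ 64 * R := by omega
    exact_mod_cast this
  have hR0 : 0 < R := by omega
  have hR0' : (0 : ℝ) < R := by exact_mod_cast hR0
  have hratio : 2 * ((2 * s ^ 4 : ℕ) : ℝ) / R * s ≤ 256 := by
    rw [div_mul_eq_mul_div, div_le_iff₀ hR0']
    push_cast
    calc 2 * (2 * (s : ℝ) ^ 4) * (s : ℝ) = 4 * (s : ℝ) ^ 5 := by ring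
      _ ≤ 256 * (R : ℝ) := by linarith
  -- Here `a = 2 s⁴` and `b = s⁴`: since `q ≤ s⁴`, at least `b` bits of `A` stay unread.
  obtain ⟨L, hL⟩ : ∃ L, h = L + 3 * (2 * s ^ 4) := ⟨h - 3 * (2 * s ^ 4), by omega⟩
  -- The exponent `N` equals `2L - 6a - 4R` and `2h = 2L + 6a`, whence the deficit `e = 12a + 4R`.
  have hfar := half_pow_mul_le (h := h) (e := 12 * (2 * s ^ 4) + 4 * R) (k := h / 4)
    (N := L - (2 * (2 * s ^ 4) + R) - (2 * (2 * s ^ 4) + R) + (L - R - (2 * (2 * s ^ 4) + R)))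
    (d := 2 * h / 1000) (by omega) (by omega) (by omega)
  have hfar' : (81 / 128 : ℝ) ^ (h / 4) ≤ γ / 8 :=
    (pow_le_pow_of_le_one (by norm_num) (by norm_num) (by omega)).trans hU.le
  clear_value R
  subst hL
  have key := RandQueryAlg.IsTester.mul_le hm (b := s ^ 4) (by linarith) hR0 (by omega) (by omega) (by omega)
    (by linarith) T hT hTq
  set f : ℝ := (1 / 2) ^ (L - (2 * (2 * s ^ 4) + R) - (2 * (2 * s ^ 4) + R) +
    (L - R - (2 * (2 * s ^ 4) + R))) * (2 ^ (L + 3 * (2 * s ^ 4)) *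
    (19 / 16) ^ (2 * (L + 3 * (2 * s ^ 4))) * 16 ^ (2 * (L + 3 * (2 * s ^ 4)) / 1000))
  set κ : ℝ := 2 * ((2 * s ^ 4 : ℕ) : ℝ) / R with hκ
  have hκ0 : 0 ≤ κ := by positivity
  have hκ1 : κ ≤ 1 := by nlinarith
  have hpow : 1 - γ / 16 ≤ (1 - κ) ^ q := by
    have h1 := one_add_mul_le_pow (show -2 ≤ -κ by linarith) q
    have h2 : (q : ℝ) * κ ≤ γ / 16 := by
      calc (q : ℝ) * κ ≤ γ / 4096 * s * κ := mul_le_mul_of_nonneg_right hqs hκ0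
        _ = γ / 4096 * (κ * s) := by ring
        _ ≤ γ / 4096 * 256 := by gcongr
        _ = γ / 16 := by ring
    rw [← sub_eq_add_neg] at h1
    linarith
  have hprod : (1 - γ / 16) * (1 - γ / 16) * ((1 - η) * (1 - γ / 8)) ≤ η := by
    refine le_trans ?_ key
    have h1 : 0 ≤ 1 - γ / 16 := by linarith
    have h2 : 0 ≤ 1 - η := by linarith
    have h3 : 0 ≤ 1 - γ / 8 := by linarith
    refine mul_le_mul (mul_le_mul hpow (by linarith) h1 (h1.trans hpow)) ?_ (mul_nonneg h2 h3)
      (mul_nonneg (h1.trans hpow) (by linarith))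
    exact mul_le_mul_of_nonneg_left (by linarith) h2
  -- The total loss is at most `γ / 4`, yet `(1 - γ/4)(1 - η) > η` because `1 - η = η + γ`.
  have h1 : 1 - γ / 4 ≤ (1 - γ / 16) * (1 - γ / 16) * (1 - γ / 8) := by nlinarith
  have h2 := mul_le_mul_of_nonneg_left h1 (show 0 ≤ 1 - η by linarith)
  nlinarith
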